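/- Let $M$ be a smooth $n$-dimensional manifold, $t_0\in\mathbb R$, and let $V=M\times(t_0,\infty)$ carry the smooth Lorentzian metric $$ {}^{(n+1)}g=-N^2\,dt^2+g_{ij}\,(dx^i+\beta^i dt)(dx^j+\beta^j dt),$$ time-oriented by increasing $t$, where $N>0$ (the lapse) is a function on $V$, $\beta$ (the shift) is a time-dependent vector field on $M$, and $g=g_t$ is a time-dependent Riemannian metric on $M$. Assume: - (bounded lapse) there are constants with $0<N_m\le N\le N_M$ on $V$; - (slice completeness) every $g_t$, $t>t_0$, is complete, and there are a complete smooth Riemannian metric $\gamma$ on $M$ and a constant $A>0$ with $A\,\gamma(v,v)\le g_t(v,v)$ for all $t>t_0$ and all tangent vectors $v$ of $M$; - (bounded shift) there is a constant $B$ with $|\beta|_{g_t}\le B$ on $V$. Let $\nabla N$ be the gradient of $N$ along the slices $M_t=M\times\{t\}$, let $K_{ij}=-N\Gamma^0_{ij}$ be the extrinsic curvature of the slices (so that $K_{ij}=-\frac1{2N}\partial_t g_{ij}$ when $\beta=0$), $\tau=g^{ij}K_{ij}$ the mean extrinsic curvature, $P_{ij}=K_{ij}-\frac{\tau}{n}g_{ij}$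 the traceless part of $K$, and $|\cdot|_g$ the pointwise norm of tensors defined by $g_t$. Suppose that the universe is expanding, $\tau\le 0$ on $V$, and that for every $t_1>t_0$: 1. $|\nabla N|_g$ is bounded on $M\times[t_1,\infty)$ by a function of $t$ that is integrable on $[t_1,\infty)$; 2. $|P|_g$ is bounded on $M\times[t_1,\infty)$ by a function of $t$ that is integrable on $[t_1,\infty)$. Then $(V,{}^{(n+1)}g)$ is future timelike and null geodesically complete: every future-directed timelike (respectively null) geodesic, with affine parameter ranging over a bounded interval $(a,b)$, extends to a future-directed timelike (respectively null) geodesic with affine parameter ranging over $(a,\infty)$. -/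

import Mathlib

open Set Filter MeasureTheory
open scoped Manifold ContDiff Topology Bundle

noncomputable section

/-! ### Metrics, Christoffel symbols and geodesics in local coordinates

`X` is a manifold without boundary, modelled on `E` through `I`.
A (pseudo-Riemannian) metric is a field `G` of bilinear forms on the tangent spaces. -/

section PseudoRiemannian

variable {E : Type*} [NormedAddCommGroup E] [NormedSpace ℝ E]
  {H : Type*} [TopologicalSpace H] (I : ModelWithCorners ℝ E H)
  {X : Type*} [TopologicalSpace X] [ChartedSpace H X]

/-- The metric `G` read in the chart `e`: the bilinear form on `E` obtained by pulling `G` back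
by the inverse of the chart. Its entries on a basis of `E` are the components `G_{αβ}`. -/
def coordMetric (G : ∀ p : X, TangentSpace I p →L[ℝ] TangentSpace I p →L[ℝ] ℝ)
    (e : OpenPartialHomeomorph X H) (y : E) : E →L[ℝ] E →L[ℝ] ℝ :=
  let A : E →L[ℝ] E := mfderiv 𝓘(ℝ, E) I (e.extend I).symm y
  let B : E →L[ℝ] E →L[ℝ] ℝ := G ((e.extend I).symm y)
  B.bilinearComp A A

/-- Christoffel symbols of the Levi-Civita connection of `G` in the chart `e`, with lowered index:
`Γ(u, v; w) = (∂_u G(v, w) + ∂_v G(u, w) - ∂_w G(u, v)) / 2 = G(∇_u v, w)`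
for vectors `u v w` that are constant in the chart. In components,
`Γ(∂_α, ∂_β; ∂_δ) = G_{δε} Γ^ε_{αβ}`. -/
def christoffel (G : ∀ p : X, TangentSpace I p →L[ℝ] TangentSpace I p →L[ℝ] ℝ)
    (e : OpenPartialHomeomorph X H) (y : E) (u v w : E) : ℝ :=
  (1 / 2 : ℝ) * (fderiv ℝ (coordMetric I G e) y u v w + fderiv ℝ (coordMetric I G e) y v u w
    - fderiv ℝ (coordMetric I G e) y w u v)

/-- `c` is a geodesic of the metric `G`, affinely parametrized by the open set `J` of
parameters: it is of class `C²`, and in every chart of the atlas its coordinates `x(s)` satisfy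
`G_{δε} (x''^ε + Γ^ε_{αβ} x'^α x'^β) = 0` for every index `δ`. (As `G` is nondegenerate, this
is `x''^ε + Γ^ε_{αβ} x'^α x'^β = 0`.) -/
def IsGeodesicOn (G : ∀ p : X, TangentSpace I p →L[ℝ] TangentSpace I p →L[ℝ] ℝ)
    (c : ℝ → X) (J : Set ℝ) : Prop :=
  ContMDiffOn 𝓘(ℝ, ℝ) I 2 c J ∧
  ∀ e ∈ atlas H X, ∀ s ∈ J, c s ∈ e.source →
    ∀ w : E,
      coordMetric I G e (e.extend I (c s)) (deriv (deriv (e.extend I ∘ c)) s) w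
        + christoffel I G e (e.extend I (c s))
            (deriv (e.extend I ∘ c) s) (deriv (e.extend I ∘ c) s) w = 0

end PseudoRiemannian

/-! ### Complete Riemannian metrics -/

/-- Smooth Riemannian metrics on the `n`-manifold `M`. -/
abbrev SmoothRiemannianMetric (n : ℕ) (M : Type*) [TopologicalSpace M]
    [ChartedSpace (EuclideanSpace ℝ (Fin n)) M] [IsManifold (𝓡 n) ∞ M] : Type _ :=
  Bundle.ContMDiffRiemannianMetric (𝓡 n) ∞ (EuclideanSpace ℝ (Fin n))
    (fun x : M => TangentSpace (𝓡 n) x)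

section Slices

variable {n : ℕ} {M : Type*} [TopologicalSpace M]
  [ChartedSpace (EuclideanSpace ℝ (Fin n)) M] [IsManifold (𝓡 n) ∞ M]

/-- The Riemannian distance of `h`: the infimum of the `h`-lengths of the `C¹` paths from `x`
to `y` (it is `∞` if there are none). -/
def riemannianDist (h : SmoothRiemannianMetric n M) (x y : M) : ENNReal :=
  letI : Bundle.RiemannianBundle (fun x : M => TangentSpace (𝓡 n) x) := ⟨h.toRiemannianMetric⟩
  Manifold.riemannianEDist (𝓡 n) x y

/-- `h` is a complete Riemannian metric: every Cauchy sequence of its distance converges. -/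
def IsCompleteMetric (h : SmoothRiemannianMetric n M) : Prop :=
  ∀ u : ℕ → M,
    (∀ ε : ENNReal, 0 < ε → ∃ k : ℕ, ∀ i ≥ k, ∀ j ≥ k, riemannianDist h (u i) (u j) < ε) →
    ∃ x : M, Tendsto u atTop (𝓝 x)

end Slices

/-! ### Spacetimes `M × (t₀, ∞)` in `n + 1` form -/

/-- The data of an `n + 1` splitting on `M × (t₀, ∞)`: smooth lapse `N > 0`, smooth shift `β`
(a time dependent vector field on `M`), and a smooth time dependent Riemannian metric `g_t`.
All of them are given by functions on `M × ℝ`, whose values at times `t ≤ t₀` are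
irrelevant. -/
structure SplitSpacetime (n : ℕ) (M : Type*) [TopologicalSpace M]
    [ChartedSpace (EuclideanSpace ℝ (Fin n)) M] [IsManifold (𝓡 n) ∞ M] where
  /-- The initial time. -/
  t₀ : ℝ
  /-- The lapse function. -/
  lapse : M × ℝ → ℝ
  /-- The shift vector. -/
  shift : ∀ p : M × ℝ, TangentSpace (𝓡 n) p.1
  /-- The metrics of the slices. -/
  slice : ℝ → SmoothRiemannianMetric n M
  lapse_pos : ∀ p : M × ℝ, t₀ < p.2 → 0 < lapse p
  lapse_smooth : ContMDiffOn ((𝓡 n).prod 𝓘(ℝ, ℝ)) 𝓘(ℝ, ℝ) ∞ lapse {p | t₀ < p.2}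
  shift_smooth : ContMDiffOn ((𝓡 n).prod 𝓘(ℝ, ℝ)) (𝓡 n).tangent ∞
    (fun p : M × ℝ => (⟨p.1, shift p⟩ : TangentBundle (𝓡 n) M)) {p | t₀ < p.2}
  slice_smooth : ContMDiffOn ((𝓡 n).prod 𝓘(ℝ, ℝ))
    ((𝓡 n).prod 𝓘(ℝ, EuclideanSpace ℝ (Fin n) →L[ℝ] EuclideanSpace ℝ (Fin n) →L[ℝ] ℝ)) ∞
    (fun p : M × ℝ => Bundle.TotalSpace.mk'
      (EuclideanSpace ℝ (Fin n) →L[ℝ] EuclideanSpace ℝ (Fin n) →L[ℝ] ℝ)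
      (E := fun x : M => TangentSpace (𝓡 n) x →L[ℝ] TangentSpace (𝓡 n) x →L[ℝ] ℝ)
      p.1 ((slice p.2).inner p.1)) {p | t₀ < p.2}

namespace SplitSpacetime

variable {n : ℕ} {M : Type*} [TopologicalSpace M]
  [ChartedSpace (EuclideanSpace ℝ (Fin n)) M] [IsManifold (𝓡 n) ∞ M]
  (S : SplitSpacetime n M)

/-- The spacetime manifold `V = M × (t₀, ∞)`, an open subset of `M × ℝ`. -/
def region : Set (M × ℝ) := {p | S.t₀ < p.2}

/-- The coframe `θⁱ = dxⁱ + βⁱ dt`: a tangent vector `(v, a)` at `p` is sent to `v + a β`. -/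
def theta (p : M × ℝ) :
    TangentSpace ((𝓡 n).prod 𝓘(ℝ, ℝ)) p →L[ℝ] TangentSpace (𝓡 n) p.1 :=
  let b : EuclideanSpace ℝ (Fin n) := S.shift p
  (ContinuousLinearMap.fst ℝ (EuclideanSpace ℝ (Fin n)) ℝ +
    (ContinuousLinearMap.snd ℝ (EuclideanSpace ℝ (Fin n)) ℝ).smulRight b :
    EuclideanSpace ℝ (Fin n) × ℝ →L[ℝ] EuclideanSpace ℝ (Fin n))

/-- The coframe `θ⁰ = dt`. -/
def dt (_S : SplitSpacetime n M) (p : M × ℝ) :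
    TangentSpace ((𝓡 n).prod 𝓘(ℝ, ℝ)) p →L[ℝ] ℝ :=
  (ContinuousLinearMap.snd ℝ (EuclideanSpace ℝ (Fin n)) ℝ :
    EuclideanSpace ℝ (Fin n) × ℝ →L[ℝ] ℝ)

/-- The Lorentzian metric `-N² (θ⁰)² + g_ij θⁱ θʲ`. -/
def spacetimeMetric (p : M × ℝ) :
    TangentSpace ((𝓡 n).prod 𝓘(ℝ, ℝ)) p →L[ℝ] TangentSpace ((𝓡 n).prod 𝓘(ℝ, ℝ)) p →L[ℝ] ℝ :=
  let g : EuclideanSpace ℝ (Fin n) →L[ℝ] EuclideanSpace ℝ (Fin n) →L[ℝ] ℝ :=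
    (S.slice p.2).inner p.1
  let θ : EuclideanSpace ℝ (Fin n) × ℝ →L[ℝ] EuclideanSpace ℝ (Fin n) := S.theta p
  let θ₀ : EuclideanSpace ℝ (Fin n) × ℝ →L[ℝ] ℝ := S.dt p
  (g.bilinearComp θ θ - (S.lapse p ^ 2) • θ₀.smulRight θ₀ :
    EuclideanSpace ℝ (Fin n) × ℝ →L[ℝ] EuclideanSpace ℝ (Fin n) × ℝ →L[ℝ] ℝ)

/-- The velocity of a curve in `M × ℝ`. -/
def velocity (_S : SplitSpacetime n M) (c : ℝ → M × ℝ) (s : ℝ) :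
    TangentSpace ((𝓡 n).prod 𝓘(ℝ, ℝ)) (c s) :=
  mfderiv 𝓘(ℝ, ℝ) ((𝓡 n).prod 𝓘(ℝ, ℝ)) c s (1 : ℝ)

/-- `c` is, on the open set `J` of affine parameters, a geodesic of the spacetime. -/
def IsGeodesic (c : ℝ → M × ℝ) (J : Set ℝ) : Prop :=
  MapsTo c J S.region ∧ IsGeodesicOn ((𝓡 n).prod 𝓘(ℝ, ℝ)) S.spacetimeMetric c J

/-- `c` is a future-directed timelike geodesic on `J`; the time orientation is by
increasing `t`. -/
def IsFutureTimelikeGeodesic (c : ℝ → M × ℝ) (J : Set ℝ) : Prop :=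
  S.IsGeodesic c J ∧ ∀ s ∈ J, 0 < S.dt (c s) (S.velocity c s) ∧
    S.spacetimeMetric (c s) (S.velocity c s) (S.velocity c s) < 0

/-- `c` is a future-directed null geodesic on `J`. -/
def IsFutureNullGeodesic (c : ℝ → M × ℝ) (J : Set ℝ) : Prop :=
  S.IsGeodesic c J ∧ ∀ s ∈ J, 0 < S.dt (c s) (S.velocity c s) ∧
    S.spacetimeMetric (c s) (S.velocity c s) (S.velocity c s) = 0

/-- Future timelike geodesic completeness: every future-directed timelike geodesic, defined for
affine parameters in a bounded interval `(a, b)`, can be continued, as such a geodesic, to all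
affine parameters in `(a, ∞)`. -/
def FutureTimelikeGeodesicallyComplete : Prop :=
  ∀ (a b : ℝ) (c : ℝ → M × ℝ), a < b → S.IsFutureTimelikeGeodesic c (Ioo a b) →
    ∃ c' : ℝ → M × ℝ, EqOn c' c (Ioo a b) ∧ S.IsFutureTimelikeGeodesic c' (Ioi a)

/-- Future null geodesic completeness. -/
def FutureNullGeodesicallyComplete : Prop :=
  ∀ (a b : ℝ) (c : ℝ → M × ℝ), a < b → S.IsFutureNullGeodesic c (Ioo a b) →
    ∃ c' : ℝ → M × ℝ, EqOn c' c (Ioo a b) ∧ S.IsFutureNullGeodesic c' (Ioi a)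

/-! #### Space gradient of the lapse and extrinsic curvature

At `p = (x, t)`, components are taken with respect to the basis `∂_i` of the tangent space
of `M` at `x` given by the preferred chart at `x`. Scalars such as `τ` and the norms below do not
depend on this choice. -/

/-- The coordinate vector `∂_i` of `M` at `x`. -/
def basisVec (x : M) (i : Fin n) : TangentSpace (𝓡 n) x :=
  (EuclideanSpace.single i (1 : ℝ) : EuclideanSpace ℝ (Fin n))

/-- The components `g_ij` of the metric of the slice. -/
def gMat (p : M × ℝ) : Matrix (Fin n) (Fin n) ℝ :=
  Matrix.of fun i j => (S.slice p.2).inner p.1 (basisVec p.1 i) (basisVec p.1 j)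

/-- The derivative `∂_i N` of the lapse along the slice. -/
def dLapse (p : M × ℝ) (i : Fin n) : ℝ :=
  mfderiv (𝓡 n) 𝓘(ℝ, ℝ) (fun x : M => S.lapse (x, p.2)) p.1 (basisVec p.1 i)

/-- `|∇N|_g = (g^{ij} ∂_i N ∂_j N)^{1/2}`. -/
def normGradLapse (p : M × ℝ) : ℝ :=
  Real.sqrt (∑ i, ∑ j, (S.gMat p)⁻¹ i j * S.dLapse p i * S.dLapse p j)

/-- The coordinates of the future-directed unit normal `N⁻¹ (∂_t - β)` of the slices. -/
def normal (p : M × ℝ) : EuclideanSpace ℝ (Fin n) × ℝ :=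
  (-((S.lapse p)⁻¹ • (S.shift p : EuclideanSpace ℝ (Fin n))), (S.lapse p)⁻¹)

/-- The extrinsic curvature `K_ij = -N Γ⁰_ij` of the slices. Since the normal `ν` has
`G(ν, ·) = -N dt`, one has `-N Γ⁰_ij = G(∇_i ∂_j, ν)`, which is the lowered Christoffel symbol
of the spacetime metric with `ν` in the last place. If `β = 0`, this is
`K_ij = -(2N)⁻¹ ∂_t g_ij`. -/
def extrinsicCurvature (p : M × ℝ) : Matrix (Fin n) (Fin n) ℝ :=
  Matrix.of fun i j =>
    christoffel ((𝓡 n).prod 𝓘(ℝ, ℝ)) S.spacetimeMetric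
      (chartAt (ModelProd (EuclideanSpace ℝ (Fin n)) ℝ) p)
      (extChartAt ((𝓡 n).prod 𝓘(ℝ, ℝ)) p p)
      (EuclideanSpace.single i (1 : ℝ), 0) (EuclideanSpace.single j (1 : ℝ), 0) (S.normal p)

/-- The mean extrinsic curvature `τ = g^{ij} K_ij`. -/
def meanCurvature (p : M × ℝ) : ℝ :=
  ∑ i, ∑ j, (S.gMat p)⁻¹ i j * S.extrinsicCurvature p i j

/-- The traceless part `P_ij = K_ij - (τ / n) g_ij` of the extrinsic curvature. -/
def tracelessPart (p : M × ℝ) : Matrix (Fin n) (Fin n) ℝ :=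
  S.extrinsicCurvature p - (S.meanCurvature p / n) • S.gMat p

/-- `|P|_g = (g^{ik} g^{jl} P_ij P_kl)^{1/2}`. -/
def normTracelessPart (p : M × ℝ) : ℝ :=
  Real.sqrt (∑ i, ∑ j, ∑ k, ∑ l,
    (S.gMat p)⁻¹ i k * (S.gMat p)⁻¹ j l * S.tracelessPart p i j * S.tracelessPart p k l)

/-! #### The hypotheses -/

/-- Bounded lapse: `0 < N_m ≤ N ≤ N_M` for constants `N_m`, `N_M`. -/
def BoundedLapse : Prop :=
  ∃ Nm NM : ℝ, 0 < Nm ∧ ∀ p ∈ S.region, Nm ≤ S.lapse p ∧ S.lapse p ≤ NM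

/-- Slice completeness: the metrics `g_t` are complete and uniformly bounded below by a
complete metric `γ` on `M`. -/
def SliceComplete : Prop :=
  (∀ t > S.t₀, IsCompleteMetric (S.slice t)) ∧
  ∃ γ : SmoothRiemannianMetric n M, IsCompleteMetric γ ∧
    ∃ A : ℝ, 0 < A ∧ ∀ p ∈ S.region, ∀ v : TangentSpace (𝓡 n) p.1,
      A * γ.inner p.1 v v ≤ (S.slice p.2).inner p.1 v v

/-- Uniformly bounded shift: `|β|_{g_t} ≤ B` for a constant `B`. -/
def BoundedShift : Prop :=
  ∃ B : ℝ, ∀ p ∈ S.region,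
    Real.sqrt ((S.slice p.2).inner p.1 (S.shift p) (S.shift p)) ≤ B

/-- For each `t₁ > t₀`, the function `F` on the spacetime is bounded by a function of `t` that is
integrable on `[t₁, ∞)`. -/
def IntegrablyBounded (F : M × ℝ → ℝ) : Prop :=
  ∀ t₁ > S.t₀, ∃ f : ℝ → ℝ, IntegrableOn f (Ici t₁) ∧
    ∀ (x : M) (t : ℝ), t₁ ≤ t → F (x, t) ≤ f t

/-- The universe is expanding: `τ ≤ 0`. -/
def Expanding : Prop := ∀ p ∈ S.region, S.meanCurvature p ≤ 0

end SplitSpacetime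

end

/-!
Along a future-directed causal geodesic `c(s) = (x(s), t(s))` consider the energy
`E = -G(c', ν) = N t'` measured by the observers with velocity `ν`, the unit normal of the slices.
The geodesic equation, tested against `ν`, gives
`E' = K(w, w) - t' dN(w)`, where `w = x' + t' β` is the part of the velocity tangent to the slices
(`SplitSpacetime.hasDerivAt_energy`). As `c` is causal, `|w| ≤ E`. Write `K = P + (τ / n) g`: the
term with `τ ≤ 0` only helps, and the Cauchy--Schwarz inequality bounds the others, so that
`(log E)' ≤ t' (|∇N| + N |P|)` (`SplitSpacetime.energy_deriv_le`). The right side is `t'` times a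
function dominated by an integrable function of `t`; hence `E` stays bounded, no matter whether `t`
does (`exists_bound_of_deriv_le`, `SplitSpacetime.exists_energy_le`).

If the parameter interval `(a, b)` is bounded, then `t' = E / N` is bounded, so `t` converges to a
finite value as `s → b`, and `|x'|` is bounded in the complete metric `γ`, because the shift is
bounded and `γ` is dominated by the slice metrics. By completeness `x(s)` converges along a sequence
of parameters tending to `b`, and the coordinate velocities stay in a compact set. The
geodesic flow started at a parameter close to `b` therefore runs past `b`
(`SplitSpacetime.exists_extension`, which rests on `IsPseudoMetricOn.exists_extension` and on the
uniform local existence statement `exists_integralCurve_mem`). The square of the velocity is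
constant along a geodesic, and a nonconstant geodesic with causal velocity has `t' ≠ 0`, so the
extension is again future-directed with the same causal character
(`SplitSpacetime.isCausalGeodesicAt_of_mem`). Since every finite endpoint can be passed, a maximal
continuation, which exists by Zorn's lemma, is defined on `(a, ∞)` (`exists_extension_Ioi`).

Mathlib has no pseudo-Riemannian geodesics. The facts needed here (local existence and uniqueness,
invariance under changes of chart, conservation of the square of the velocity) are obtained from
the geodesic vector field on the phase space `E × E` of a chart.
-/

noncomputable section

set_option maxSynthPendingDepth 3

/-! ### The geodesic equation in coordinates -/

section CoordinateGeodesics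

variable {E : Type*} [NormedAddCommGroup E] [NormedSpace ℝ E]

/-- The lowered Christoffel symbols `Γ(u, v; w)` of a field `g` of bilinear forms on `E`. -/
def coordChristoffel (g : E → E →L[ℝ] E →L[ℝ] ℝ) (y u v w : E) : ℝ :=
  (1 / 2 : ℝ) * (fderiv ℝ g y u v w + fderiv ℝ g y v u w - fderiv ℝ g y w u v)

/-- The geodesic equation of `g` at the parameter `s` of a curve `x` in `E`, tested against all
vectors. -/
def GeodesicEqAt (g : E → E →L[ℝ] E →L[ℝ] ℝ) (x : ℝ → E) (s : ℝ) : Prop :=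
  ∀ w : E, g (x s) (deriv (deriv x) s) w
    + coordChristoffel g (x s) (deriv x s) (deriv x s) w = 0

/-- The linear form `w ↦ Γ(v, v; w)`. -/
def geodesicForm (g : E → E →L[ℝ] E →L[ℝ] ℝ) (y v : E) : E →L[ℝ] ℝ :=
  fderiv ℝ g y v v - (1 / 2 : ℝ) • ((fderiv ℝ g y).flip v).flip v

/-- The geodesic vector field `(y, v) ↦ (v, -Γ(v, v))` of `g` on the phase space `E × E`; the index
of `Γ(v, v; ·)` is raised by the inverse of `g y : E → E*`, so that the value is only meaningful
where `g` is nondegenerate. -/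
def geodesicField (g : E → E →L[ℝ] E →L[ℝ] ℝ) (z : E × E) : E × E :=
  (z.2, -ContinuousLinearMap.inverse (g z.1) (geodesicForm g z.1 z.2))

lemma ContDiffAt.hasDerivAt_deriv {x : ℝ → E} {s : ℝ} (hx : ContDiffAt ℝ 2 x s) :
    HasDerivAt (deriv x) (deriv (deriv x) s) s := by
  have h : ContDiffAt ℝ 1 (deriv x) s :=
    (hx.fderiv_right (m := 1) (by norm_num)).clm_apply contDiffAt_const
  exact (h.differentiableAt (by norm_num)).hasDerivAt

lemma geodesicForm_apply (g : E → E →L[ℝ] E →L[ℝ] ℝ) (y v w : E) :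
    geodesicForm g y v w = coordChristoffel g y v v w := by
  simp [geodesicForm, coordChristoffel]; ring

lemma isInvertible_of_nondegenerate [FiniteDimensional ℝ E] {b : E →L[ℝ] E →L[ℝ] ℝ}
    (hb : ∀ v, (∀ w, b v w = 0) → v = 0) : b.IsInvertible := by
  have hinj : Function.Injective (b : E →ₗ[ℝ] (E →L[ℝ] ℝ)) := by
    rw [← LinearMap.ker_eq_bot, LinearMap.ker_eq_bot']
    intro v hv
    exact hb v fun w => by
      have := congrArg (fun f : E →L[ℝ] ℝ => f w) hv
      simpa using this
  have hdim : Module.finrank ℝ E = Module.finrank ℝ (E →L[ℝ] ℝ) := by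
    rw [← (LinearMap.toContinuousLinearMap (𝕜 := ℝ) (E := E) (F' := ℝ)).finrank_eq]
    exact (Subspace.dual_finrank_eq (K := ℝ) (V := E)).symm
  refine ⟨(LinearEquiv.ofInjectiveOfFinrankEq _ hinj hdim).toContinuousLinearEquiv, ?_⟩
  ext v w
  rfl

lemma contDiffAt_geodesicField [FiniteDimensional ℝ E] {g : E → E →L[ℝ] E →L[ℝ] ℝ} {z : E × E}
    (hg : ContDiffAt ℝ 2 g z.1) (hb : ∀ v, (∀ w, g z.1 v w = 0) → v = 0) :
    ContDiffAt ℝ 1 (geodesicField g) z := by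
  have : CompleteSpace E := FiniteDimensional.complete ℝ E
  have hg1 : ContDiffAt ℝ 1 (fun z : E × E => g z.1) z :=
    (hg.of_le (by norm_num)).comp z contDiffAt_fst
  have hd : ContDiffAt ℝ 1 (fun z : E × E => fderiv ℝ g z.1) z :=
    (hg.fderiv_right (m := 1) (by norm_num)).comp z contDiffAt_fst
  have hinv : ContDiffAt ℝ 1 (fun z : E × E => ContinuousLinearMap.inverse (g z.1)) z :=
    ContDiffAt.comp (g := ContinuousLinearMap.inverse) z
      (isInvertible_of_nondegenerate hb).contDiffAt_map_inverse hg1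
  have hsnd : ContDiffAt ℝ 1 (fun z : E × E => z.2) z := contDiffAt_snd
  have hform : ContDiffAt ℝ 1 (fun z : E × E => geodesicForm g z.1 z.2) z := by
    have hflip : ContDiffAt ℝ 1 (fun z : E × E => (fderiv ℝ g z.1).flip) z :=
      (ContinuousLinearMap.flipₗᵢ ℝ E E (E →L[ℝ] ℝ)).contDiff.contDiffAt.comp z hd
    have hflip2 : ContDiffAt ℝ 1 (fun z : E × E => ((fderiv ℝ g z.1).flip z.2).flip) z :=
      (ContinuousLinearMap.flipₗᵢ ℝ E E ℝ).contDiff.contDiffAt.comp z (hflip.clm_apply hsnd)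
    exact ((hd.clm_apply hsnd).clm_apply hsnd).sub ((hflip2.clm_apply hsnd).const_smul _)
  exact hsnd.prodMk (hinv.clm_apply hform).neg

/-- Along a geodesic, position and velocity form an integral curve of the geodesic field. -/
lemma GeodesicEqAt.hasDerivAt_geodesicField [FiniteDimensional ℝ E]
    {g : E → E →L[ℝ] E →L[ℝ] ℝ} {x : ℝ → E} {s : ℝ} (h : GeodesicEqAt g x s)
    (hx : ContDiffAt ℝ 2 x s) (hb : ∀ v, (∀ w, g (x s) v w = 0) → v = 0) :
    HasDerivAt (fun s => (x s, deriv x s)) (geodesicField g (x s, deriv x s)) s := by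
  have h1 : HasDerivAt x (deriv x s) s := (hx.differentiableAt (by norm_num)).hasDerivAt
  have h2 : HasDerivAt (deriv x) (deriv (deriv x) s) s :=
    hx.hasDerivAt_deriv
  have h3 : deriv (deriv x) s
      = -ContinuousLinearMap.inverse (g (x s)) (geodesicForm g (x s) (deriv x s)) := by
    have hi := isInvertible_of_nondegenerate hb
    have : g (x s) (deriv (deriv x) s) = -geodesicForm g (x s) (deriv x s) := by
      ext w
      have := h w
      rw [← geodesicForm_apply] at this
      simp only [neg_apply]
      linarith
    rw [← map_neg, ← this]
    obtain ⟨e, he⟩ := hi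
    rw [← he]
    simp
  unfold geodesicField
  rw [h3] at h2
  exact h1.prodMk h2

/-- Integral curves of the geodesic field project to geodesics of class `C²`. -/
lemma geodesicEqAt_of_hasDerivAt [FiniteDimensional ℝ E]
    {g : E → E →L[ℝ] E →L[ℝ] ℝ} {z : ℝ → E × E} {J : Set ℝ} (hJ : IsOpen J)
    (hz : ∀ s ∈ J, HasDerivAt z (geodesicField g (z s)) s)
    (hg : ∀ s ∈ J, ContDiffAt ℝ 2 g (z s).1)
    (hb : ∀ s ∈ J, ∀ v, (∀ w, g (z s).1 v w = 0) → v = 0) :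
    ∀ s ∈ J, ContDiffAt ℝ 2 (fun s => (z s).1) s ∧ deriv (fun s => (z s).1) s = (z s).2 ∧
      GeodesicEqAt g (fun s => (z s).1) s := by
  have h1 : ∀ s ∈ J, HasDerivAt (fun s => (z s).1) (z s).2 s := fun s hs => (hz s hs).fst
  have h2 : ∀ s ∈ J, HasDerivAt (fun s => (z s).2) (geodesicField g (z s)).2 s :=
    fun s hs => (hz s hs).snd
  intro s hs
  have hev : ∀ᶠ r in 𝓝 s, r ∈ J := hJ.mem_nhds hs
  have hd : deriv (fun s => (z s).1) =ᶠ[𝓝 s] fun s => (z s).2 :=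
    hev.mono fun r hr => (h1 r hr).deriv
  have hz1 : ContDiffOn ℝ 1 z J := by
    rw [show (1 : WithTop ℕ∞) = 0 + 1 by norm_num, contDiffOn_succ_iff_deriv_of_isOpen hJ]
    refine ⟨fun r hr => (hz r hr).differentiableAt.differentiableWithinAt, by simp, ?_⟩
    rw [contDiffOn_zero]
    refine ContinuousOn.congr (f := fun r => geodesicField g (z r)) ?_
      fun r hr => (hz r hr).deriv
    intro r hr
    exact ((contDiffAt_geodesicField (hg r hr) (hb r hr)).continuousAt.comp
      (hz r hr).continuousAt).continuousWithinAt
  have hC2 : ContDiffOn ℝ 2 (fun s => (z s).1) J := by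
    rw [show (2 : WithTop ℕ∞) = 1 + 1 by norm_num, contDiffOn_succ_iff_deriv_of_isOpen hJ]
    refine ⟨fun r hr => (h1 r hr).differentiableAt.differentiableWithinAt, by simp, ?_⟩
    exact hz1.snd.congr fun r hr => (h1 r hr).deriv
  refine ⟨hC2.contDiffAt hev, (h1 s hs).deriv, fun w => ?_⟩
  rw [hd.deriv_eq, (h2 s hs).deriv, (h1 s hs).deriv, ← geodesicForm_apply]
  obtain ⟨e, he⟩ := isInvertible_of_nondegenerate (hb s hs)
  simp only [geodesicField, ← he]
  simp

/-- The quantity `g(x', x')` is conserved along geodesics. -/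
lemma GeodesicEqAt.hasDerivAt_inner_self {g : E → E →L[ℝ] E →L[ℝ] ℝ} {x : ℝ → E} {s : ℝ}
    (h : GeodesicEqAt g x s) (hx : ContDiffAt ℝ 2 x s) (hg : DifferentiableAt ℝ g (x s))
    (hsymm : ∀ u v, g (x s) u v = g (x s) v u) :
    HasDerivAt (fun s => g (x s) (deriv x s) (deriv x s)) 0 s := by
  have h1 : HasDerivAt x (deriv x s) s := (hx.differentiableAt (by norm_num)).hasDerivAt
  have h2 : HasDerivAt (deriv x) (deriv (deriv x) s) s :=
    hx.hasDerivAt_deriv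
  have h3 : HasDerivAt (fun s => g (x s)) (fderiv ℝ g (x s) (deriv x s)) s := by
    exact HasFDerivAt.comp_hasDerivAt (l := g) s hg.hasFDerivAt h1
  have h4 := (h3.clm_apply h2).clm_apply h2
  refine h4.congr_deriv ?_
  have h5 := h (deriv x s)
  simp only [coordChristoffel] at h5
  rw [_root_.add_apply]
  rw [hsymm (deriv x s) (deriv (deriv x) s)]
  linarith

/-- The derivative of the coefficients of the pullback `g = φ^* g'`, by the chain and product
rules. -/
lemma fderiv_pullback_apply {g g' : E → E →L[ℝ] E →L[ℝ] ℝ} {φ : E → E} {y : E}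
    (hφ : ContDiffAt ℝ 2 φ y) (hg' : DifferentiableAt ℝ g' (φ y))
    (hg : g =ᶠ[𝓝 y] fun y => (g' (φ y)).bilinearComp (fderiv ℝ φ y) (fderiv ℝ φ y))
    (u v w : E) :
    fderiv ℝ g y u v w
      = fderiv ℝ g' (φ y) (fderiv ℝ φ y u) (fderiv ℝ φ y v) (fderiv ℝ φ y w)
        + g' (φ y) (fderiv ℝ (fderiv ℝ φ) y u v) (fderiv ℝ φ y w)
        + g' (φ y) (fderiv ℝ φ y v) (fderiv ℝ (fderiv ℝ φ) y u w) := by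
  have h1 : HasFDerivAt φ (fderiv ℝ φ y) y :=
    (hφ.differentiableAt (by norm_num)).hasFDerivAt
  have h2 : HasFDerivAt (fderiv ℝ φ) (fderiv ℝ (fderiv ℝ φ) y) y :=
    ((hφ.fderiv_right (m := 1) (by norm_num)).differentiableAt (by norm_num)).hasFDerivAt
  have h3 : HasFDerivAt (fun y => g' (φ y)) ((fderiv ℝ g' (φ y)).comp (fderiv ℝ φ y)) y :=
    HasFDerivAt.comp (g := g') y hg'.hasFDerivAt h1
  have h4 : DifferentiableAt ℝ g y := by
    refine DifferentiableAt.congr_of_eventuallyEq ?_ hg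
    have h5 : DifferentiableAt ℝ (fun y => (g' (φ y)).comp (fderiv ℝ φ y)) y :=
      h3.differentiableAt.clm_comp h2.differentiableAt
    have h6 : DifferentiableAt ℝ (fun y => ((g' (φ y)).comp (fderiv ℝ φ y)).flip) y :=
      (ContinuousLinearMap.flipₗᵢ ℝ E E ℝ).differentiable.differentiableAt.comp y h5
    have h7 : DifferentiableAt ℝ
        (fun y => (((g' (φ y)).comp (fderiv ℝ φ y)).flip.comp (fderiv ℝ φ y)).flip) y :=
      (ContinuousLinearMap.flipₗᵢ ℝ E E ℝ).differentiable.differentiableAt.comp y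
        (h6.clm_comp h2.differentiableAt)
    exact h7
  have h8 : HasFDerivAt (fun y => g y v w) _ y :=
    (h4.hasFDerivAt.clm_apply (hasFDerivAt_const v y)).clm_apply (hasFDerivAt_const w y)
  have h9 : HasFDerivAt (fun y => g' (φ y) (fderiv ℝ φ y v) (fderiv ℝ φ y w)) _ y :=
    (h3.clm_apply (h2.clm_apply (hasFDerivAt_const v y))).clm_apply
      (h2.clm_apply (hasFDerivAt_const w y))
  have h10 : (fun y => g y v w) =ᶠ[𝓝 y]
      fun y => g' (φ y) (fderiv ℝ φ y v) (fderiv ℝ φ y w) :=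
    hg.mono fun z hz => by simp [hz]
  have h11 := congrArg (fun L : E →L[ℝ] ℝ => L u) (h8.unique (h9.congr_of_eventuallyEq h10))
  simp at h11
  rw [h11]
  ring

/-- The geodesic equation is invariant under changes of coordinates: the terms with second
derivatives of `φ` in the Christoffel symbols and in `(φ ∘ x)''` cancel. -/
lemma GeodesicEqAt.comp {g g' : E → E →L[ℝ] E →L[ℝ] ℝ} {φ : E → E} {x : ℝ → E} {s : ℝ}
    (h : GeodesicEqAt g x s) (hx : ContDiffAt ℝ 2 x s) (hφ : ContDiffAt ℝ 2 φ (x s))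
    (hg' : DifferentiableAt ℝ g' (φ (x s))) (hsymm : ∀ u v, g' (φ (x s)) u v = g' (φ (x s)) v u)
    (hg : g =ᶠ[𝓝 (x s)] fun y => (g' (φ y)).bilinearComp (fderiv ℝ φ y) (fderiv ℝ φ y))
    (hsurj : Function.Surjective (fderiv ℝ φ (x s))) :
    GeodesicEqAt g' (φ ∘ x) s := by
  have hcx : ContinuousAt x s := hx.continuousAt
  have hx2 : HasDerivAt (deriv x) (deriv (deriv x) s) s := hx.hasDerivAt_deriv
  have hx1 : ∀ᶠ r in 𝓝 s, HasDerivAt x (deriv x r) r :=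
    (hx.eventually (by norm_num)).mono fun r hr => (hr.differentiableAt (by norm_num)).hasDerivAt
  have hφ1 : ∀ᶠ y in 𝓝 (x s), HasFDerivAt φ (fderiv ℝ φ y) y :=
    (hφ.eventually (by norm_num)).mono fun r hr => (hr.differentiableAt (by norm_num)).hasFDerivAt
  have hφ2 : HasFDerivAt (fderiv ℝ φ) (fderiv ℝ (fderiv ℝ φ) (x s)) (x s) :=
    ((hφ.fderiv_right (m := 1) (by norm_num)).differentiableAt (by norm_num)).hasFDerivAt
  have hd1 : deriv (φ ∘ x) =ᶠ[𝓝 s] fun r => fderiv ℝ φ (x r) (deriv x r) := by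
    filter_upwards [hx1, hcx.eventually hφ1] with r h1 h2
    exact (h2.comp_hasDerivAt r h1).deriv
  have hd2 : deriv (deriv (φ ∘ x)) s
      = fderiv ℝ (fderiv ℝ φ) (x s) (deriv x s) (deriv x s)
        + fderiv ℝ φ (x s) (deriv (deriv x) s) := by
    rw [hd1.deriv_eq]
    exact ((HasFDerivAt.comp_hasDerivAt (l := fderiv ℝ φ) s hφ2 hx1.self_of_nhds).clm_apply
      hx2).deriv
  have hsy : ∀ u v, fderiv ℝ (fderiv ℝ φ) (x s) u v = fderiv ℝ (fderiv ℝ φ) (x s) v u := by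
    intro u v
    exact (hφ.isSymmSndFDerivAt (by simp)).eq u v
  intro w'
  obtain ⟨w, rfl⟩ := hsurj w'
  have h0 := h w
  have hgx : g (x s) (deriv (deriv x) s) w
      = g' (φ (x s)) (fderiv ℝ φ (x s) (deriv (deriv x) s)) (fderiv ℝ φ (x s) w) := by
    simp [hg.self_of_nhds]
  rw [hgx] at h0
  simp only [coordChristoffel, fderiv_pullback_apply hφ hg' hg] at h0 ⊢
  rw [hd2, hd1.self_of_nhds]
  simp only [Function.comp_apply, map_add]
  rw [_root_.add_apply]
  rw [hsy w (deriv x s), hsymm (fderiv ℝ (fderiv ℝ φ) (x s) (deriv x s) w)] at h0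
  linarith

/-- Local existence of integral curves, uniform in the initial point near `z₀`; they stay in a
prescribed neighbourhood of `z₀`. -/
lemma exists_integralCurve_mem {V : Type*} [NormedAddCommGroup V] [NormedSpace ℝ V]
    [CompleteSpace V] {f : V → V} {z₀ : V} (hf : ContDiffAt ℝ 1 f z₀) {U : Set V} (hU : U ∈ 𝓝 z₀) :
    ∃ r > (0 : ℝ), ∃ ε > (0 : ℝ),
      ∀ z ∈ Metric.closedBall z₀ r, ∀ t₀ : ℝ, ∃ α : ℝ → V, α t₀ = z ∧
        ∀ t ∈ Ioo (t₀ - ε) (t₀ + ε), HasDerivAt α (f (α t)) t ∧ α t ∈ U := by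
  obtain ⟨ε₀, hε₀, a, r₀, L, K, hr₀, hPL⟩ := IsPicardLindelof.of_contDiffAt_one hf
  obtain ⟨δ, hδ, hδU⟩ := Metric.mem_nhds_iff.mp hU
  have ha : 0 < a := by
    have h1 := (hPL 0).mul_max_le
    have h2 : (0 : ℝ) ≤ L * max ((0 : ℝ) + ε₀ - 0) (0 - (0 - ε₀)) :=
      mul_nonneg L.2 (le_max_of_le_left (by linarith))
    have h3 : (r₀ : ℝ) ≤ a := by simpa using h2.trans h1
    exact lt_of_lt_of_le hr₀ (by exact_mod_cast h3)
  -- a smaller Picard–Lindelöf ball, contained in `U`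
  let a' : NNReal := min a (Real.toNNReal (δ / 2))
  have ha' : 0 < a' := lt_min ha (by simpa using hδ)
  have ha'U : Metric.closedBall z₀ a' ⊆ U := by
    refine (Metric.closedBall_subset_ball ?_).trans hδU
    have h1 : (a' : ℝ) ≤ δ / 2 := by
      have : a' ≤ Real.toNNReal (δ / 2) := min_le_right _ _
      have h2 : (a' : ℝ) ≤ (Real.toNNReal (δ / 2) : ℝ) := by exact_mod_cast this
      rwa [Real.coe_toNNReal _ (by positivity)] at h2
    linarith
  obtain ⟨ε, hε, h0⟩ := (hPL 0).exists_shrink_radius hε₀ (min_le_left a (Real.toNNReal (δ / 2)))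
    (NNReal.half_lt_self ha'.ne')
  have hPL' : ∀ t₀ : ℝ, IsPicardLindelof (fun _ ↦ f) (tmin := t₀ - ε) (tmax := t₀ + ε)
      ⟨t₀, (by simp [le_of_lt hε])⟩ z₀ a' (a' / 2) L K := by
    intro t₀
    refine IsPicardLindelof.of_time_independent (h0.norm_le 0 (by simp [hε.le]))
      (h0.lipschitzOnWith 0 (by simp [hε.le])) ?_
    simpa [a'] using h0.mul_max_le
  refine ⟨(a' / 2 : NNReal), by simpa using ha', ε, hε, fun z hz t₀ => ?_⟩
  obtain ⟨α, hα⟩ := ODE.FunSpace.exists_isFixedPt_next (hPL' t₀) hz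
  have hmem : ∀ t, α.compProj t ∈ Metric.closedBall z₀ a' :=
    fun t => α.compProj_mem_closedBall (hPL' t₀).mul_max_le
  refine ⟨α.compProj, ?_, fun t ht => ⟨?_, ha'U (hmem t)⟩⟩
  · have h1 := ODE.FunSpace.compProj_val (α := α) (t := ⟨t₀, by simp [hε.le]⟩)
    rw [← hα, ODE.FunSpace.next_apply₀, hα] at h1
    exact h1
  · have ht' : t ∈ Icc (t₀ - ε) (t₀ + ε) := Ioo_subset_Icc_self ht
    refine HasDerivWithinAt.hasDerivAt (s := Icc (t₀ - ε) (t₀ + ε)) ?_ (Icc_mem_nhds ht.1 ht.2)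
    apply (ODE.hasDerivWithinAt_picard_Icc (t₀ := t₀) (by simp [hε.le])
        (hPL' t₀).continuousOn_uncurry
      α.continuous_compProj.continuousOn (fun t _ ↦ hmem t) z ht').congr_of_mem _ ht'
    intro t' ht'
    nth_rw 1 [← hα]
    rw [ODE.FunSpace.compProj_of_mem ht', ODE.FunSpace.next_apply]

end CoordinateGeodesics

/-! ### Charts, velocities and coordinate metrics on a manifold -/

section ManifoldGeodesics

variable {E : Type*} [NormedAddCommGroup E] [NormedSpace ℝ E]
  {H : Type*} [TopologicalSpace H] {I : ModelWithCorners ℝ E H}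
  {X : Type*} [TopologicalSpace X] [ChartedSpace H X]

variable (I) in
/-- The differential at `y` of the inverse of the chart `e`: it sends the coordinates in `e` of a
tangent vector to its coordinates in the preferred chart, which are used for `TangentSpace`. -/
def chartFrame (e : OpenPartialHomeomorph X H) (y : E) : E →L[ℝ] E :=
  mfderiv 𝓘(ℝ, E) I (e.extend I).symm y

variable (I) in
/-- The differential at `p` of the chart `e`. -/
def chartCoframe (e : OpenPartialHomeomorph X H) (p : X) : E →L[ℝ] E :=
  mfderiv I 𝓘(ℝ, E) (e.extend I) p

variable (I) in
/-- The velocity of a curve, in the preferred chart at its position. -/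
def curveVelocity (c : ℝ → X) (s : ℝ) : E :=
  mfderiv 𝓘(ℝ, ℝ) I c s (1 : ℝ)

/-- The bilinear form of `G` at `p`, on the model space. -/
def metricAt (G : ∀ p : X, TangentSpace I p →L[ℝ] TangentSpace I p →L[ℝ] ℝ) (p : X) :
    E →L[ℝ] E →L[ℝ] ℝ :=
  G p

variable {G : ∀ p : X, TangentSpace I p →L[ℝ] TangentSpace I p →L[ℝ] ℝ}
  {e e' : OpenPartialHomeomorph X H}

lemma coordMetric_apply (y u v : E) :
    coordMetric I G e y u v
      = metricAt G ((e.extend I).symm y) (chartFrame I e y u) (chartFrame I e y v) :=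
  rfl

section Charts

omit [ChartedSpace H X] in
lemma mem_extend_target {p : X} (hp : p ∈ e.source) : e.extend I p ∈ (e.extend I).target :=
  (e.extend I).map_source (by rwa [e.extend_source])

omit [ChartedSpace H X] in
lemma extend_left_inv' {p : X} (hp : p ∈ e.source) : (e.extend I).symm (e.extend I p) = p :=
  (e.extend I).left_inv (by rwa [e.extend_source])

variable [I.Boundaryless]

omit [ChartedSpace H X] in
lemma extend_target_mem_nhds' {y : E} (hy : y ∈ (e.extend I).target) :
    (e.extend I).target ∈ 𝓝 y :=
  e.isOpen_extend_target.mem_nhds hy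

variable [IsManifold I ∞ X]

omit [I.Boundaryless] in
lemma contMDiffAt_extend_of_mem_atlas (he : e ∈ atlas H X) {p : X} (hp : p ∈ e.source) :
    ContMDiffAt I 𝓘(ℝ, E) ∞ (e.extend I) p :=
  e.contMDiffAt_extend (IsManifold.subset_maximalAtlas he) hp

lemma contMDiffAt_extend_symm_of_mem_atlas (he : e ∈ atlas H X) {y : E}
    (hy : y ∈ (e.extend I).target) : ContMDiffAt 𝓘(ℝ, E) I ∞ (e.extend I).symm y := by
  refine (contMDiffOn_extend_symm (n := ∞) (I := I) (IsManifold.subset_maximalAtlas he)).contMDiffAt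
      ?_
  rw [← e.extend_target']
  exact extend_target_mem_nhds' hy

lemma chartCoframe_chartFrame (he : e ∈ atlas H X) {y : E} (hy : y ∈ (e.extend I).target) (v : E) :
    chartCoframe I e ((e.extend I).symm y) (chartFrame I e y v) = v := by
  have hp : (e.extend I).symm y ∈ e.source := by
    rw [← e.extend_source (I := I)]; exact (e.extend I).map_target hy
  have h1 := ((contMDiffAt_extend_of_mem_atlas (I := I) he hp).mdifferentiableAt
      (by simp)).hasMFDerivAt
  have h2 := ((contMDiffAt_extend_symm_of_mem_atlas (I := I) he hy).mdifferentiableAt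
      (by simp)).hasMFDerivAt
  have h3 := h1.comp y h2
  have h4 : HasMFDerivAt 𝓘(ℝ, E) 𝓘(ℝ, E) (e.extend I ∘ (e.extend I).symm) y
      (ContinuousLinearMap.id ℝ E) := by
    refine (hasMFDerivAt_id y).congr_of_eventuallyEq ?_
    filter_upwards [extend_target_mem_nhds' hy] with z hz
    exact (e.extend I).right_inv hz
  exact congrArg (fun L : E →L[ℝ] E => L v) (hasMFDerivAt_unique h3 h4)

lemma chartFrame_chartCoframe (he : e ∈ atlas H X) {p : X} (hp : p ∈ e.source) (v : E) :
    chartFrame I e (e.extend I p) (chartCoframe I e p v) = v := by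
  have h1 := ((contMDiffAt_extend_of_mem_atlas (I := I) he hp).mdifferentiableAt
      (by simp)).hasMFDerivAt
  have h2 := ((contMDiffAt_extend_symm_of_mem_atlas (I := I) he
      (mem_extend_target (I := I) hp)).mdifferentiableAt
    (by simp)).hasMFDerivAt
  have h3 := h2.comp p h1
  have h4 : HasMFDerivAt I I ((e.extend I).symm ∘ e.extend I) p
      (ContinuousLinearMap.id ℝ E) := by
    refine (hasMFDerivAt_id p).congr_of_eventuallyEq ?_
    filter_upwards [e.open_source.mem_nhds hp] with z hz
    exact (e.extend I).left_inv (by rwa [e.extend_source])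
  exact congrArg (fun L : E →L[ℝ] E => L v) (hasMFDerivAt_unique h3 h4)

omit [I.Boundaryless] in
lemma contDiffAt_extend_comp (he : e ∈ atlas H X) {c : ℝ → X} {s : ℝ} (hs : c s ∈ e.source)
    {k : WithTop ℕ∞} (hk : k ≤ ∞) (hc : ContMDiffAt 𝓘(ℝ, ℝ) I k c s) :
    ContDiffAt ℝ k (e.extend I ∘ c) s :=
  (((contMDiffAt_extend_of_mem_atlas (I := I) he hs).of_le hk).comp s hc).contDiffAt

/-- The velocity of a curve is the image of its coordinate velocity. -/
lemma mfderiv_eq_chartFrame (he : e ∈ atlas H X) {c : ℝ → X} {s : ℝ} (hs : c s ∈ e.source)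
    (hc : ContMDiffAt 𝓘(ℝ, ℝ) I 1 c s) :
    curveVelocity I c s
      = chartFrame I e (e.extend I (c s)) (deriv (e.extend I ∘ c) s) := by
  have h1 := ((contDiffAt_extend_comp he hs (by norm_cast) hc).differentiableAt
    (by norm_num)).hasDerivAt.hasFDerivAt.hasMFDerivAt
  have h2 := ((contMDiffAt_extend_symm_of_mem_atlas (I := I) he
      (mem_extend_target (I := I) hs)).mdifferentiableAt
    (by simp)).hasMFDerivAt
  have h3 := HasMFDerivAt.comp (g := (e.extend I).symm) s h2 h1
  have h4 : HasMFDerivAt 𝓘(ℝ, ℝ) I c s _ := h3.congr_of_eventuallyEq (by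
    filter_upwards [hc.continuousAt.preimage_mem_nhds (e.open_source.mem_nhds hs)] with r hr
    exact (extend_left_inv' hr).symm)
  rw [curveVelocity, h4.mfderiv]
  exact congrArg (chartFrame I e (e.extend I (c s))) (one_smul ℝ _)

/-- The velocity of a curve, squared by `G`, computed in a chart. -/
lemma coordMetric_deriv_deriv (he : e ∈ atlas H X) {c : ℝ → X} {s : ℝ} (hs : c s ∈ e.source)
    (hc : ContMDiffAt 𝓘(ℝ, ℝ) I 1 c s) :
    coordMetric I G e (e.extend I (c s)) (deriv (e.extend I ∘ c) s) (deriv (e.extend I ∘ c) s)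
      = metricAt G (c s) (curveVelocity I c s) (curveVelocity I c s) := by
  rw [coordMetric_apply, ← mfderiv_eq_chartFrame he hs hc, extend_left_inv' hs]

/-- The velocity vanishes iff the coordinate velocity does. -/
lemma deriv_extend_eq_zero_iff (he : e ∈ atlas H X) {c : ℝ → X} {s : ℝ} (hs : c s ∈ e.source)
    (hc : ContMDiffAt 𝓘(ℝ, ℝ) I 1 c s) :
    deriv (e.extend I ∘ c) s = 0 ↔ curveVelocity I c s = 0 := by
  rw [mfderiv_eq_chartFrame he hs hc]
  refine ⟨fun h => by rw [h, map_zero], fun h => ?_⟩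
  rw [← chartCoframe_chartFrame he (mem_extend_target (I := I) hs) (deriv (e.extend I ∘ c) s), h,
    map_zero]

/-- The transition map between two charts pulls back one coordinate metric to the other. -/
lemma coordMetric_eventuallyEq (he : e ∈ atlas H X) (he' : e' ∈ atlas H X) {p : X}
    (hp : p ∈ e.source) (hp' : p ∈ e'.source) :
    coordMetric I G e =ᶠ[𝓝 (e.extend I p)] fun y =>
      (coordMetric I G e' ((e'.extend I ∘ (e.extend I).symm) y)).bilinearComp
        (fderiv ℝ (e'.extend I ∘ (e.extend I).symm) y)
        (fderiv ℝ (e'.extend I ∘ (e.extend I).symm) y) := by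
  have hcont : ContinuousAt (e.extend I).symm (e.extend I p) :=
    (contMDiffAt_extend_symm_of_mem_atlas (I := I) he (mem_extend_target hp)).continuousAt
  have h1 : ∀ᶠ y in 𝓝 (e.extend I p), (e.extend I).symm y ∈ e'.source :=
    hcont.eventually (e'.open_source.mem_nhds (by rwa [extend_left_inv' hp]))
  have h2 : ∀ᶠ y in 𝓝 (e.extend I p), y ∈ (e.extend I).target :=
    extend_target_mem_nhds' (mem_extend_target hp)
  filter_upwards [h1.eventually_nhds, h2] with y hy hy2
  have hy1 := hy.self_of_nhds
  have hA : chartFrame I e y = (chartFrame I e' (e'.extend I ((e.extend I).symm y))).comp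
      (fderiv ℝ (e'.extend I ∘ (e.extend I).symm) y) := by
    have d1 := ((contMDiffAt_extend_symm_of_mem_atlas (I := I) he hy2).mdifferentiableAt
        (by simp)).hasMFDerivAt
    have d2 := ((contMDiffAt_extend_of_mem_atlas (I := I) he' hy1).mdifferentiableAt
        (by simp)).hasMFDerivAt
    have d3 := d2.comp y d1
    have d3' : HasMFDerivAt 𝓘(ℝ, E) 𝓘(ℝ, E) (e'.extend I ∘ (e.extend I).symm) y
        (fderiv ℝ (e'.extend I ∘ (e.extend I).symm) y) := by
      have := d3.mdifferentiableAt.hasMFDerivAt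
      rwa [mfderiv_eq_fderiv] at this
    have d4 := ((contMDiffAt_extend_symm_of_mem_atlas (I := I) he'
      (mem_extend_target (I := I) hy1)).mdifferentiableAt (by simp)).hasMFDerivAt
    have d5 := HasMFDerivAt.comp (g := (e'.extend I).symm) y d4 d3'
    have d6 : HasMFDerivAt 𝓘(ℝ, E) I (e.extend I).symm y _ := d5.congr_of_eventuallyEq (by
      filter_upwards [hy] with z hz
      exact (extend_left_inv' hz).symm)
    exact hasMFDerivAt_unique d1 d6
  ext u v
  rw [ContinuousLinearMap.bilinearComp_apply, coordMetric_apply, coordMetric_apply, hA,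
    Function.comp_apply, extend_left_inv' hy1]
  rfl

lemma contDiffAt_transition (he : e ∈ atlas H X) (he' : e' ∈ atlas H X) {p : X}
    (hp : p ∈ e.source) (hp' : p ∈ e'.source) :
    ContDiffAt ℝ ∞ (e'.extend I ∘ (e.extend I).symm) (e.extend I p) := by
  have h1 := contMDiffAt_extend_symm_of_mem_atlas he (mem_extend_target (I := I) hp)
  have h2 : ContMDiffAt I 𝓘(ℝ, E) ∞ (e'.extend I) ((e.extend I).symm (e.extend I p)) :=
    contMDiffAt_extend_of_mem_atlas he' (by rwa [extend_left_inv' hp])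
  exact (h2.comp _ h1).contDiffAt

lemma surjective_fderiv_transition (he : e ∈ atlas H X) (he' : e' ∈ atlas H X) {p : X}
    (hp : p ∈ e.source) (hp' : p ∈ e'.source) :
    Function.Surjective (fderiv ℝ (e'.extend I ∘ (e.extend I).symm) (e.extend I p)) := by
  have h1 := ((contDiffAt_transition (I := I) he he' hp hp').differentiableAt (by simp)).hasFDerivAt
  have h2 := ((contDiffAt_transition (I := I) he' he hp' hp).differentiableAt (by simp)).hasFDerivAt
  have heq : (e'.extend I ∘ (e.extend I).symm) (e.extend I p) = e'.extend I p := by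
    simp only [Function.comp_apply, extend_left_inv' hp]
  have heq' : (e.extend I ∘ (e'.extend I).symm) (e'.extend I p) = e.extend I p := by
    simp only [Function.comp_apply, extend_left_inv' hp']
  rw [← heq'] at h1
  have h3 := h1.comp _ h2
  have h4 : HasFDerivAt ((e'.extend I ∘ (e.extend I).symm) ∘ (e.extend I ∘ (e'.extend I).symm))
      (ContinuousLinearMap.id ℝ E) (e'.extend I p) := by
    refine (hasFDerivAt_id _).congr_of_eventuallyEq ?_
    have hcont : ContinuousAt (e'.extend I).symm (e'.extend I p) :=
      (contMDiffAt_extend_symm_of_mem_atlas (I := I) he' (mem_extend_target hp')).continuousAt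
    filter_upwards [hcont.eventually (e.open_source.mem_nhds (by rwa [extend_left_inv' hp'])),
      extend_target_mem_nhds' (mem_extend_target (I := I) hp')] with y hy hy'
    simp only [Function.comp_apply, extend_left_inv' hy, id]
    exact (e'.extend I).right_inv hy'
  intro w
  refine ⟨fderiv ℝ (e.extend I ∘ (e'.extend I).symm) (e'.extend I p) w, ?_⟩
  have h5 := congrArg (fun L : E →L[ℝ] E => L w) (h3.unique h4)
  rw [heq'] at h5
  exact h5

end Charts

variable (I) in
/-- `G` is a pseudo-Riemannian metric of class `C²` on the set `R`. -/
structure IsPseudoMetricOn (G : ∀ p : X, TangentSpace I p →L[ℝ] TangentSpace I p →L[ℝ] ℝ)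
    (R : Set X) : Prop where
  symm : ∀ p ∈ R, ∀ u v : E, metricAt G p u v = metricAt G p v u
  nondegenerate : ∀ p ∈ R, ∀ v : E, (∀ w : E, metricAt G p v w = 0) → v = 0
  contDiffAt : ∀ e ∈ atlas H X, ∀ p ∈ R, p ∈ e.source →
    ContDiffAt ℝ 2 (coordMetric I G e) (e.extend I p)

lemma IsPseudoMetricOn.coordMetric_symm {R : Set X} (h : IsPseudoMetricOn I G R) {y : E}
    (hy : (e.extend I).symm y ∈ R) (u v : E) :
    coordMetric I G e y u v = coordMetric I G e y v u :=
  h.symm _ hy _ _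

namespace IsPseudoMetricOn

variable [I.Boundaryless] [IsManifold I ∞ X] {R : Set X}

lemma coordMetric_nondegenerate (h : IsPseudoMetricOn I G R) (he : e ∈ atlas H X) {y : E}
    (hyt : y ∈ (e.extend I).target) (hy : (e.extend I).symm y ∈ R) (v : E)
    (hv : ∀ w, coordMetric I G e y v w = 0) : v = 0 := by
  have h1 : chartFrame I e y v = 0 := by
    refine h.nondegenerate _ hy _ fun w => ?_
    have h2 := hv (chartCoframe I e ((e.extend I).symm y) w)
    have hp : (e.extend I).symm y ∈ e.source := by
      rw [← e.extend_source (I := I)]; exact (e.extend I).map_target hyt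
    have h3 := chartFrame_chartCoframe (I := I) he hp w
    rw [(e.extend I).right_inv hyt] at h3
    rw [coordMetric_apply, h3] at h2
    exact h2
  rw [← chartCoframe_chartFrame he hyt v, h1, map_zero]

/-- It suffices to check the geodesic equation in one chart. -/
lemma geodesicEqAt_of_chart (h : IsPseudoMetricOn I G R) (he : e ∈ atlas H X) (he' : e' ∈ atlas H X)
    {c : ℝ → X} {s : ℝ} (hc : ContMDiffAt 𝓘(ℝ, ℝ) I 2 c s) (hR : c s ∈ R) (hs : c s ∈ e.source)
    (hs' : c s ∈ e'.source) (hgeo : GeodesicEqAt (coordMetric I G e) (e.extend I ∘ c) s) :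
    GeodesicEqAt (coordMetric I G e') (e'.extend I ∘ c) s := by
  have heq : (e'.extend I ∘ (e.extend I).symm) (e.extend I (c s)) = e'.extend I (c s) := by
    simp only [Function.comp_apply, extend_left_inv' hs]
  have h1 := hgeo.comp (g' := coordMetric I G e') (φ := e'.extend I ∘ (e.extend I).symm)
    (contDiffAt_extend_comp he hs (by norm_cast) hc)
    ((contDiffAt_transition (I := I) he he' hs hs').of_le (by norm_cast))
    (by
      have := (h.contDiffAt e' he' (c s) hR hs').differentiableAt (by norm_num)
      rw [← heq] at this
      exact this)
    (fun u v => by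
      refine h.coordMetric_symm ?_ u v
      show (e'.extend I).symm ((e'.extend I ∘ (e.extend I).symm) (e.extend I (c s))) ∈ R
      rwa [heq, extend_left_inv' hs'])
    (coordMetric_eventuallyEq he he' hs hs')
    (surjective_fderiv_transition (I := I) he he' hs hs')
  have h2 : (e'.extend I ∘ (e.extend I).symm) ∘ (e.extend I ∘ c) =ᶠ[𝓝 s] e'.extend I ∘ c := by
    filter_upwards [hc.continuousAt.preimage_mem_nhds (e.open_source.mem_nhds hs)] with r hr
    simp only [Function.comp_apply]
    rw [extend_left_inv' hr]
  intro w
  have h3 := h1 w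
  rw [h2.deriv.deriv_eq, h2.deriv_eq, h2.self_of_nhds] at h3
  exact h3

end IsPseudoMetricOn

end ManifoldGeodesics

/-! ### Uniqueness and extension of geodesics on a manifold -/

section GeodesicUniqueness

variable {E : Type*} [NormedAddCommGroup E] [NormedSpace ℝ E]
  {H : Type*} [TopologicalSpace H] {I : ModelWithCorners ℝ E H}
  {X : Type*} [TopologicalSpace X] [ChartedSpace H X]

lemma GeodesicEqAt.congr {g : E → E →L[ℝ] E →L[ℝ] ℝ} {x x' : ℝ → E} {s : ℝ}
    (h : GeodesicEqAt g x s) (hx : x =ᶠ[𝓝 s] x') : GeodesicEqAt g x' s := by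
  intro w
  rw [← hx.deriv.deriv_eq, ← hx.deriv_eq, ← hx.self_of_nhds]
  exact h w

variable (I) in
/-- The geodesic condition at a single parameter `s`; it only depends on the germ of `c` at `s`. -/
def IsGeodesicAt (G : ∀ p : X, TangentSpace I p →L[ℝ] TangentSpace I p →L[ℝ] ℝ)
    (c : ℝ → X) (s : ℝ) : Prop :=
  ContMDiffAt 𝓘(ℝ, ℝ) I 2 c s ∧ ∀ e ∈ atlas H X, c s ∈ e.source →
    GeodesicEqAt (coordMetric I G e) (e.extend I ∘ c) s

variable {G : ∀ p : X, TangentSpace I p →L[ℝ] TangentSpace I p →L[ℝ] ℝ}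
  {e : OpenPartialHomeomorph X H} {R : Set X} {c c' : ℝ → X} {s a b : ℝ}

lemma isGeodesicOn_iff {J : Set ℝ} (hJ : IsOpen J) :
    IsGeodesicOn I G c J ↔ ∀ s ∈ J, IsGeodesicAt I G c s := by
  refine ⟨fun h s hs => ⟨h.1.contMDiffAt (hJ.mem_nhds hs), fun e he hse => h.2 e he s hs hse⟩,
    fun h => ⟨fun s hs => (h s hs).1.contMDiffWithinAt, fun e he s hs hse => (h s hs).2 e he hse⟩⟩

lemma IsGeodesicAt.congr (h : IsGeodesicAt I G c s) (hc : c =ᶠ[𝓝 s] c') :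
    IsGeodesicAt I G c' s := by
  refine ⟨h.1.congr_of_eventuallyEq hc.symm, fun e he hs => ?_⟩
  rw [← hc.self_of_nhds] at hs
  exact (h.2 e he hs).congr (hc.fun_comp (e.extend I))

lemma curveVelocity_congr (hc : c =ᶠ[𝓝 s] c') : curveVelocity I c s = curveVelocity I c' s :=
  congrArg (fun L : ℝ →L[ℝ] E => L 1) hc.mfderiv_eq

variable [FiniteDimensional ℝ E] [I.Boundaryless] [IsManifold I ∞ X]

/-- In a chart, position and velocity along a geodesic form an integral curve of the geodesic
field. -/
lemma IsPseudoMetricOn.eventually_hasDerivAt (h : IsPseudoMetricOn I G R) (he : e ∈ atlas H X)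
    (hgeo : ∀ᶠ r in 𝓝 s, IsGeodesicAt I G c r ∧ c r ∈ R) (hs : c s ∈ e.source) :
    ∀ᶠ r in 𝓝 s, HasDerivAt (fun r => ((e.extend I ∘ c) r, deriv (e.extend I ∘ c) r))
      (geodesicField (coordMetric I G e) ((e.extend I ∘ c) r, deriv (e.extend I ∘ c) r)) r := by
  have hcont : ContinuousAt c s := hgeo.self_of_nhds.1.1.continuousAt
  filter_upwards [hgeo, hcont.preimage_mem_nhds (e.open_source.mem_nhds hs)] with r hr hrs
  refine (hr.1.2 e he hrs).hasDerivAt_geodesicField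
    (contDiffAt_extend_comp he hrs (by norm_cast) hr.1.1) fun v hv => ?_
  refine h.coordMetric_nondegenerate he (mem_extend_target (I := I) hrs) ?_ v hv
  rw [extend_left_inv' hrs]
  exact hr.2

/-- Local uniqueness of geodesics. -/
lemma IsPseudoMetricOn.eventuallyEq_of_deriv_eq (h : IsPseudoMetricOn I G R) (he : e ∈ atlas H X)
    (hgeo : ∀ᶠ r in 𝓝 s, IsGeodesicAt I G c r ∧ c r ∈ R)
    (hgeo' : ∀ᶠ r in 𝓝 s, IsGeodesicAt I G c' r ∧ c' r ∈ R)
    (hs : c s ∈ e.source) (heq : c s = c' s)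
    (hd : deriv (e.extend I ∘ c) s = deriv (e.extend I ∘ c') s) : c =ᶠ[𝓝 s] c' := by
  have hs' : c' s ∈ e.source := heq ▸ hs
  have h1 := h.eventually_hasDerivAt he hgeo hs
  have h2 := h.eventually_hasDerivAt he hgeo' hs'
  have hxx : (e.extend I ∘ c) s = (e.extend I ∘ c') s := congrArg (e.extend I) heq
  have hF : ContDiffAt ℝ 1 (geodesicField (coordMetric I G e))
      ((e.extend I ∘ c) s, deriv (e.extend I ∘ c) s) := by
    refine contDiffAt_geodesicField (h.contDiffAt e he _ hgeo.self_of_nhds.2 hs) fun v hv => ?_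
    refine h.coordMetric_nondegenerate he (mem_extend_target (I := I) hs) ?_ v hv
    rw [extend_left_inv' hs]
    exact hgeo.self_of_nhds.2
  obtain ⟨K, T, hT, hlip⟩ := hF.exists_lipschitzOnWith
  have hT' : T ∈ 𝓝 ((e.extend I ∘ c') s, deriv (e.extend I ∘ c') s) := by rwa [← hxx, ← hd]
  have h3 := ODE_solution_unique_of_eventually (v := fun _ => geodesicField (coordMetric I G e))
    (s := fun _ => T) (.of_forall fun _ => hlip)
    (h1.and (h1.self_of_nhds.continuousAt.preimage_mem_nhds hT))
    (h2.and (h2.self_of_nhds.continuousAt.preimage_mem_nhds hT')) (by rw [hxx, hd])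
  filter_upwards [h3,
    hgeo.self_of_nhds.1.1.continuousAt.preimage_mem_nhds (e.open_source.mem_nhds hs),
    hgeo'.self_of_nhds.1.1.continuousAt.preimage_mem_nhds (e.open_source.mem_nhds hs')]
    with r hr hr1 hr2
  have h4 : e.extend I (c r) = e.extend I (c' r) := congrArg Prod.fst hr
  rw [← extend_left_inv' (I := I) hr1, h4, extend_left_inv' hr2]

/-- Two geodesics on an interval which agree near one parameter agree everywhere. -/
lemma IsPseudoMetricOn.eqOn_Ioo [T2Space X] (h : IsPseudoMetricOn I G R)
    (hgeo : ∀ r ∈ Ioo a b, IsGeodesicAt I G c r ∧ c r ∈ R)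
    (hgeo' : ∀ r ∈ Ioo a b, IsGeodesicAt I G c' r ∧ c' r ∈ R)
    (hs : s ∈ Ioo a b) (heq : c =ᶠ[𝓝 s] c') : ∀ r ∈ Ioo a b, c =ᶠ[𝓝 r] c' := by
  have hopen : IsOpen {r | c =ᶠ[𝓝 r] c'} :=
    isOpen_iff_mem_nhds.2 fun r hr => hr.eventuallyEq_nhds
  refine isPreconnected_Ioo.subset_of_closure_inter_subset hopen ⟨s, hs, heq⟩ ?_
  rintro r ⟨hr, hrJ⟩
  have hev : ∀ᶠ q in 𝓝 r, q ∈ Ioo a b := isOpen_Ioo.mem_nhds hrJ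
  have hg := hev.mono hgeo
  have hg' := hev.mono hgeo'
  have hfr : ∃ᶠ q in 𝓝 r, c =ᶠ[𝓝 q] c' := mem_closure_iff_frequently.1 hr
  have hcr : c r = c' r := tendsto_nhds_unique_of_frequently_eq
    hg.self_of_nhds.1.1.continuousAt hg'.self_of_nhds.1.1.continuousAt
    (hfr.mono fun q hq => hq.self_of_nhds)
  have hsrc : c r ∈ (chartAt H (c r)).source := mem_chart_source H (c r)
  have hsrc' : c' r ∈ (chartAt H (c r)).source := hcr ▸ hsrc
  refine h.eventuallyEq_of_deriv_eq (chart_mem_atlas H (c r)) hg hg' hsrc hcr ?_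
  have hd := ((contDiffAt_extend_comp (chart_mem_atlas H (c r)) hsrc (by norm_cast)
    hg.self_of_nhds.1.1).hasDerivAt_deriv).continuousAt
  have hd' := ((contDiffAt_extend_comp (chart_mem_atlas H (c r)) hsrc' (by norm_cast)
    hg'.self_of_nhds.1.1).hasDerivAt_deriv).continuousAt
  exact tendsto_nhds_unique_of_frequently_eq hd hd' (hfr.mono fun q hq =>
    (hq.fun_comp ((chartAt H (c r)).extend I)).deriv_eq)

omit [FiniteDimensional ℝ E] [I.Boundaryless] [IsManifold I ∞ X] in
/-- Constant curves are geodesics. -/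
lemma isGeodesicAt_const (p : X) : IsGeodesicAt I G (fun _ => p) s := by
  refine ⟨contMDiffAt_const, fun e he hp w => ?_⟩
  have h1 : e.extend I ∘ (fun _ : ℝ => p) = fun _ => e.extend I p := rfl
  have h2 : deriv (fun _ : ℝ => e.extend I p) = fun _ => 0 := by ext; simp
  have h3 : deriv (fun _ : ℝ => (0 : E)) = fun _ => 0 := by ext; simp
  rw [h1, h2, h3]
  simp [coordChristoffel]

/-- A geodesic whose velocity vanishes once is constant. -/
lemma IsPseudoMetricOn.curveVelocity_eq_zero [T2Space X] (h : IsPseudoMetricOn I G R)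
    (hgeo : ∀ r ∈ Ioo a b, IsGeodesicAt I G c r ∧ c r ∈ R) (hs : s ∈ Ioo a b)
    (hv : curveVelocity I c s = 0) : ∀ r ∈ Ioo a b, curveVelocity I c r = 0 := by
  have hconst : ∀ r ∈ Ioo a b, IsGeodesicAt I G (fun _ => c s) r ∧ c s ∈ R :=
    fun r _ => ⟨isGeodesicAt_const _, (hgeo s hs).2⟩
  have hev : ∀ᶠ q in 𝓝 s, q ∈ Ioo a b := isOpen_Ioo.mem_nhds hs
  have hsrc : c s ∈ (chartAt H (c s)).source := mem_chart_source H (c s)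
  have heq : c =ᶠ[𝓝 s] fun _ => c s := by
    refine h.eventuallyEq_of_deriv_eq (chart_mem_atlas H (c s)) (hev.mono hgeo) (hev.mono hconst)
      hsrc rfl ?_
    rw [(deriv_extend_eq_zero_iff (I := I) (chart_mem_atlas H (c s)) hsrc
      ((hgeo s hs).1.1.of_le (by norm_num))).2 hv]
    exact (deriv_const s _).symm
  intro r hr
  rw [curveVelocity_congr (h.eqOn_Ioo hgeo hconst hs heq r hr)]
  simp only [curveVelocity, mfderiv_const]
  rfl

omit [FiniteDimensional ℝ E] in
/-- The square of the velocity is conserved along geodesics. -/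
lemma IsPseudoMetricOn.metricAt_curveVelocity_eq (h : IsPseudoMetricOn I G R)
    (hgeo : ∀ r ∈ Ioo a b, IsGeodesicAt I G c r ∧ c r ∈ R) {r : ℝ} (hs : s ∈ Ioo a b)
    (hr : r ∈ Ioo a b) :
    metricAt G (c s) (curveVelocity I c s) (curveVelocity I c s)
      = metricAt G (c r) (curveVelocity I c r) (curveVelocity I c r) := by
  have hder : ∀ q ∈ Ioo a b, HasDerivAt
      (fun q => metricAt G (c q) (curveVelocity I c q) (curveVelocity I c q)) 0 q := by
    intro q hq
    have he := chart_mem_atlas H (c q)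
    have hsrc : c q ∈ (chartAt H (c q)).source := mem_chart_source H (c q)
    have h1 := ((hgeo q hq).1.2 _ he hsrc).hasDerivAt_inner_self
      (contDiffAt_extend_comp he hsrc (by norm_cast) (hgeo q hq).1.1)
      ((h.contDiffAt _ he _ (hgeo q hq).2 hsrc).differentiableAt (by norm_num))
      (h.coordMetric_symm (by
        show ((chartAt H (c q)).extend I).symm ((chartAt H (c q)).extend I (c q)) ∈ R
        rw [extend_left_inv' hsrc]
        exact (hgeo q hq).2))
    refine h1.congr_of_eventuallyEq ?_
    filter_upwards [isOpen_Ioo.mem_nhds hq, (hgeo q hq).1.1.continuousAt.preimage_mem_nhds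
      ((chartAt H (c q)).open_source.mem_nhds hsrc)] with t ht hts
    exact (coordMetric_deriv_deriv he hts ((hgeo t ht).1.1.of_le (by norm_num))).symm
  exact isOpen_Ioo.is_const_of_deriv_eq_zero isPreconnected_Ioo
    (fun q hq => (hder q hq).differentiableAt.differentiableWithinAt)
    (fun q hq => (hder q hq).deriv) hs hr

/-- A geodesic on `(a, b)` which, along parameters tending to `b`, converges to a point of `R` with
bounded coordinate velocity, extends beyond `b`. -/
lemma IsPseudoMetricOn.exists_extension [T2Space X] (h : IsPseudoMetricOn I G R) (hR : IsOpen R)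
    (hgeo : ∀ r ∈ Ioo a b, IsGeodesicAt I G c r ∧ c r ∈ R) {p₀ : X} (hp₀ : p₀ ∈ R)
    (he : e ∈ atlas H X) (hpe : p₀ ∈ e.source) {u : ℕ → ℝ} (hu : ∀ k, u k ∈ Ioo a b)
    (hub : Tendsto u atTop (𝓝 b)) (hcu : Tendsto (fun k => c (u k)) atTop (𝓝 p₀)) {C : ℝ}
    (hC : ∀ᶠ k in atTop, ‖deriv (e.extend I ∘ c) (u k)‖ ≤ C) :
    ∃ b' > b, ∃ c' : ℝ → X, EqOn c' c (Ioo a b) ∧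
      ∀ r ∈ Ioo a b', IsGeodesicAt I G c' r ∧ c' r ∈ R := by
  have : CompleteSpace E := FiniteDimensional.complete ℝ E
  have : ProperSpace E := FiniteDimensional.proper ℝ E
  obtain ⟨v₀, -, φ, hφ, hv₀⟩ := tendsto_subseq_of_frequently_bounded
    (x := fun k => deriv (e.extend I ∘ c) (u k)) (Metric.isBounded_closedBall (x := (0 : E))
        (r := C))
    (hC.frequently.mono fun k hk => by simpa using hk)
  set g := coordMetric I G e with hg
  set y₀ := e.extend I p₀ with hy₀
  have hy₀t : y₀ ∈ (e.extend I).target := mem_extend_target hpe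
  have hcontR : ∀ᶠ y in 𝓝 y₀, (e.extend I).symm y ∈ R :=
    (contMDiffAt_extend_symm_of_mem_atlas (I := I) he hy₀t).continuousAt.eventually
      (hR.mem_nhds (by rwa [hy₀, extend_left_inv' hpe]))
  have hF : ContDiffAt ℝ 1 (geodesicField g) (y₀, v₀) := by
    refine contDiffAt_geodesicField (h.contDiffAt e he _ hp₀ hpe) fun v hv => ?_
    exact h.coordMetric_nondegenerate he hy₀t hcontR.self_of_nhds v hv
  have hU : {z : E × E | z.1 ∈ (e.extend I).target ∧ (e.extend I).symm z.1 ∈ R} ∈ 𝓝 (y₀, v₀) :=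
    continuousAt_fst.preimage_mem_nhds (x := ((y₀, v₀) : E × E))
      (inter_mem (extend_target_mem_nhds' hy₀t) hcontR)
  obtain ⟨ρ, hρ, ε, hε, hflow⟩ := exists_integralCurve_mem hF hU
  -- a parameter `σ` so close to `b` that the local flow started there passes `b`
  have hyk : Tendsto (fun k => ((e.extend I ∘ c) (u (φ k)), deriv (e.extend I ∘ c) (u (φ k))))
      atTop (𝓝 (y₀, v₀)) := by
    refine Tendsto.prodMk_nhds ?_ hv₀
    exact ((contMDiffAt_extend_of_mem_atlas (I := I) he hpe).continuousAt.tendsto.comp hcu).comp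
      hφ.tendsto_atTop
  obtain ⟨k, hk1, hk2, hk3⟩ := ((hyk.eventually (Metric.closedBall_mem_nhds _ hρ)).and
    (((hub.comp hφ.tendsto_atTop).eventually (lt_mem_nhds (by linarith : b - ε < b))).and
    ((hcu.comp hφ.tendsto_atTop).eventually (e.open_source.mem_nhds hpe)))).exists
  set σ := u (φ k) with hσ
  have hσab : σ ∈ Ioo a b := hu _
  have hk2 : b - ε < σ := hk2
  have hk3 : c σ ∈ e.source := hk3
  obtain ⟨α, hα0, hα⟩ := hflow _ hk1 σ
  have hαR : ∀ t ∈ Ioo (σ - ε) (σ + ε), (e.extend I).symm (α t).1 ∈ R := fun t ht => (hα t ht).2.2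
  have hsrc : ∀ t ∈ Ioo (σ - ε) (σ + ε), (e.extend I).symm (α t).1 ∈ e.source := fun t ht => by
    rw [← e.extend_source (I := I)]; exact (e.extend I).map_target (hα t ht).2.1
  have hα' := geodesicEqAt_of_hasDerivAt (g := g) isOpen_Ioo (fun t ht => (hα t ht).1)
    (fun t ht => by
      have h1 := h.contDiffAt e he _ (hαR t ht) (hsrc t ht)
      rwa [(e.extend I).right_inv (hα t ht).2.1] at h1)
    (fun t ht v hv => h.coordMetric_nondegenerate he (hα t ht).2.1 (hαR t ht) v hv)
  set d : ℝ → X := fun t => (e.extend I).symm (α t).1 with hd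
  have hdx : ∀ t ∈ Ioo (σ - ε) (σ + ε), e.extend I ∘ d =ᶠ[𝓝 t] fun t => (α t).1 := fun t ht => by
    filter_upwards [isOpen_Ioo.mem_nhds ht] with r hr
    exact (e.extend I).right_inv (hα r hr).2.1
  have hdgeo : ∀ t ∈ Ioo (σ - ε) (σ + ε), IsGeodesicAt I G d t ∧ d t ∈ R := by
    intro t ht
    have hd2 : ContMDiffAt 𝓘(ℝ, ℝ) I 2 d t :=
      ((contMDiffAt_extend_symm_of_mem_atlas (I := I) he (hα t ht).2.1).of_le (by norm_cast)).comp
        t (hα' t ht).1.contMDiffAt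
    refine ⟨⟨hd2, fun e' he' hs' => ?_⟩, hαR t ht⟩
    exact h.geodesicEqAt_of_chart he he' hd2 (hαR t ht) (hsrc t ht) hs'
      ((hα' t ht).2.2.congr (hdx t ht).symm)
  have hσd : σ ∈ Ioo (σ - ε) (σ + ε) := ⟨by linarith, by linarith⟩
  have hcd : c =ᶠ[𝓝 σ] d := by
    refine h.eventuallyEq_of_deriv_eq he ((isOpen_Ioo.eventually_mem hσab).mono hgeo)
      ((isOpen_Ioo.eventually_mem hσd).mono hdgeo) hk3 ?_ ?_
    · simp only [hd, hα0]
      exact (extend_left_inv' hk3).symm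
    · rw [(hdx σ hσd).deriv_eq, (hα' σ hσd).2.1, hα0]
  have hcd' : ∀ r ∈ Ioo (max a (σ - ε)) b, c =ᶠ[𝓝 r] d := by
    refine h.eqOn_Ioo (fun r hr => hgeo r ⟨(le_max_left _ _).trans_lt hr.1, hr.2⟩)
      (fun r hr => hdgeo r ⟨(le_max_right _ _).trans_lt hr.1, hr.2.trans (by linarith)⟩)
      ⟨max_lt hσab.1 (by linarith), hσab.2⟩ hcd
  refine ⟨σ + ε, by linarith, fun t => if t < b then c t else d t, fun t ht => if_pos ht.2,
    fun r hr => ?_⟩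
  have hc1 : ∀ q < b, c =ᶠ[𝓝 q] fun t => if t < b then c t else d t := fun q hq => by
    filter_upwards [Iio_mem_nhds hq] with t ht
    exact (if_pos ht).symm
  rcases lt_or_ge r b with hrb | hrb
  · refine ⟨(hgeo r ⟨hr.1, hrb⟩).1.congr (hc1 r hrb), ?_⟩
    rw [← (hc1 r hrb).self_of_nhds]
    exact (hgeo r ⟨hr.1, hrb⟩).2
  · have hσr : max a (σ - ε) < r := lt_of_lt_of_le (max_lt (hσab.1.trans hσab.2)
      (by linarith [hσab.2])) hrb
    have hd1 : d =ᶠ[𝓝 r] fun t => if t < b then c t else d t := by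
      filter_upwards [Ioi_mem_nhds hσr] with t ht
      split_ifs with htb
      · exact (hcd' t ⟨ht, htb⟩).self_of_nhds.symm
      · rfl
    have hrd : r ∈ Ioo (σ - ε) (σ + ε) := ⟨(le_max_right _ _).trans_lt hσr, hr.2⟩
    refine ⟨(hdgeo r hrd).1.congr hd1, ?_⟩
    rw [← hd1.self_of_nhds]
    exact (hdgeo r hrd).2

end GeodesicUniqueness

/-! ### The spacetime metric in product charts -/

section ProductCharts

variable {n : ℕ} {M : Type*} [TopologicalSpace M] [ChartedSpace (EuclideanSpace ℝ (Fin n)) M]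

/-- The chart of `M × ℝ` obtained from a chart of `M`. -/
def spacetimeChart (f : OpenPartialHomeomorph M (EuclideanSpace ℝ (Fin n))) :
    OpenPartialHomeomorph (M × ℝ) (ModelProd (EuclideanSpace ℝ (Fin n)) ℝ) :=
  f.prod (OpenPartialHomeomorph.refl ℝ)

lemma exists_eq_spacetimeChart {e : OpenPartialHomeomorph (M × ℝ)
    (ModelProd (EuclideanSpace ℝ (Fin n)) ℝ)}
    (he : e ∈ atlas (ModelProd (EuclideanSpace ℝ (Fin n)) ℝ) (M × ℝ)) : ∃ f ∈ atlas
        (EuclideanSpace ℝ (Fin n)) M, e = spacetimeChart f := by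
  obtain ⟨f, hf, g, hg, rfl⟩ := he
  rw [chartedSpaceSelf_atlas] at hg
  subst hg
  exact ⟨f, hf, rfl⟩

lemma spacetimeChart_mem_atlas {f : OpenPartialHomeomorph M (EuclideanSpace ℝ (Fin n))}
    (hf : f ∈ atlas (EuclideanSpace ℝ (Fin n)) M) :
    spacetimeChart f ∈ atlas (ModelProd (EuclideanSpace ℝ (Fin n)) ℝ) (M × ℝ) :=
  ⟨f, hf, _, chartedSpaceSelf_atlas.2 rfl, rfl⟩

variable {f : OpenPartialHomeomorph M (EuclideanSpace ℝ (Fin n))}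

omit [ChartedSpace (EuclideanSpace ℝ (Fin n)) M] in
lemma mem_spacetimeChart_source {p : M × ℝ} : p ∈ (spacetimeChart f).source ↔ p.1 ∈ f.source := by
  simp [spacetimeChart]

omit [ChartedSpace (EuclideanSpace ℝ (Fin n)) M] in
lemma spacetimeChart_extend_symm_apply (z : EuclideanSpace ℝ (Fin n) × ℝ) :
    ((spacetimeChart f).extend ((𝓡 n).prod 𝓘(ℝ, ℝ))).symm z = ((f.extend (𝓡 n)).symm z.1, z.2) :=
  rfl

variable [IsManifold (𝓡 n) ∞ M]

lemma chartFrame_spacetimeChart (hf : f ∈ atlas (EuclideanSpace ℝ (Fin n)) M)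
    {z : EuclideanSpace ℝ (Fin n) × ℝ}
    (hz : z.1 ∈ (f.extend (𝓡 n)).target) (w : EuclideanSpace ℝ (Fin n) × ℝ) :
    chartFrame ((𝓡 n).prod 𝓘(ℝ, ℝ)) (spacetimeChart f) z w
      = (chartFrame (𝓡 n) f z.1 w.1, w.2) := by
  have h1 := ((contMDiffAt_extend_symm_of_mem_atlas (I := 𝓡 n) hf hz).mdifferentiableAt
    (by simp)).hasMFDerivAt
  have hfst : HasMFDerivAt 𝓘(ℝ, (EuclideanSpace ℝ (Fin n)) × ℝ) 𝓘(ℝ, (EuclideanSpace ℝ (Fin n)))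
      (Prod.fst : EuclideanSpace ℝ (Fin n) × ℝ → EuclideanSpace ℝ (Fin n)) z
      (ContinuousLinearMap.fst ℝ (EuclideanSpace ℝ (Fin n)) ℝ) := hasFDerivAt_fst.hasMFDerivAt
  have hsnd : HasMFDerivAt 𝓘(ℝ, (EuclideanSpace ℝ (Fin n)) × ℝ) 𝓘(ℝ, ℝ)
      (Prod.snd : EuclideanSpace ℝ (Fin n) × ℝ → ℝ) z
      (ContinuousLinearMap.snd ℝ (EuclideanSpace ℝ (Fin n)) ℝ) := hasFDerivAt_snd.hasMFDerivAt
  have h2 := (HasMFDerivAt.comp (g := (f.extend (𝓡 n)).symm) z h1 hfst).prodMk hsnd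
  have h3 : HasMFDerivAt 𝓘(ℝ, (EuclideanSpace ℝ (Fin n)) × ℝ) ((𝓡 n).prod 𝓘(ℝ, ℝ))
      ((spacetimeChart f).extend ((𝓡 n).prod 𝓘(ℝ, ℝ))).symm z _ := h2
  unfold chartFrame
  rw [h3.mfderiv]
  rfl

end ProductCharts

/-- The differential of a smooth map, applied to a smooth family of tangent vectors, is a smooth
family of tangent vectors. -/
lemma contMDiffAt_mfderiv_apply {E : Type*} [NormedAddCommGroup E] [NormedSpace ℝ E]
    {H : Type*} [TopologicalSpace H] {I : ModelWithCorners ℝ E H}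
    {X : Type*} [TopologicalSpace X] [ChartedSpace H X] [IsManifold I ∞ X]
    {E' : Type*} [NormedAddCommGroup E'] [NormedSpace ℝ E']
    {H' : Type*} [TopologicalSpace H'] {I' : ModelWithCorners ℝ E' H'}
    {X' : Type*} [TopologicalSpace X'] [ChartedSpace H' X'] [IsManifold I' ∞ X']
    {F : Type*} [NormedAddCommGroup F] [NormedSpace ℝ F]
    {φ : X → X'} {b : F → X} {v : ∀ z, TangentSpace I (b z)} {z₀ : F}
    (hφ : ContMDiffAt I I' ∞ φ (b z₀))
    (hv : ContMDiffAt 𝓘(ℝ, F) I.tangent ∞ (fun z => (⟨b z, v z⟩ : TangentBundle I X)) z₀) :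
    ContMDiffAt 𝓘(ℝ, F) I'.tangent ∞
      (fun z => (⟨φ (b z), mfderiv I I' φ (b z) (v z)⟩ : TangentBundle I' X')) z₀ := by
  have hb : ContMDiffAt 𝓘(ℝ, F) I ∞ b z₀ := (Bundle.contMDiffAt_totalSpace.1 hv).1
  have h1 := ContMDiffAt.comp z₀ (hφ.mfderiv_const (m := ∞) (by simp)) hb
  exact ContMDiffAt.clm_apply_of_inCoordinates (b₁ := b) (b₂ := fun z => φ (b z))
    (ϕ := fun z => mfderiv I I' φ (b z)) h1 hv (hφ.comp z₀ hb)

namespace SplitSpacetime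

variable {n : ℕ} {M : Type*} [TopologicalSpace M] [ChartedSpace (EuclideanSpace ℝ (Fin n)) M]
  [IsManifold (𝓡 n) ∞ M] (S : SplitSpacetime n M)

/-- The lapse in the chart `f`. -/
def coordLapse (f : OpenPartialHomeomorph M (EuclideanSpace ℝ (Fin n)))
    (z : EuclideanSpace ℝ (Fin n) × ℝ) : ℝ :=
  S.lapse ((f.extend (𝓡 n)).symm z.1, z.2)

/-- The components of the shift in the chart `f`. -/
def coordShift (f : OpenPartialHomeomorph M (EuclideanSpace ℝ (Fin n)))
    (z : EuclideanSpace ℝ (Fin n) × ℝ) : EuclideanSpace ℝ (Fin n) :=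
  chartCoframe (𝓡 n) f ((f.extend (𝓡 n)).symm z.1)
    (S.shift ((f.extend (𝓡 n)).symm z.1, z.2) : EuclideanSpace ℝ (Fin n))

/-- The components of the slice metrics in the chart `f`. -/
def coordSlice (f : OpenPartialHomeomorph M (EuclideanSpace ℝ (Fin n)))
    (z : EuclideanSpace ℝ (Fin n) × ℝ) : EuclideanSpace ℝ (Fin n) →L[ℝ] EuclideanSpace ℝ
    (Fin n) →L[ℝ] ℝ :=
  coordMetric (𝓡 n) (S.slice z.2).inner f z.1

/-- The slice metric at `p`, on the model space. -/
def sliceAt (p : M × ℝ) : EuclideanSpace ℝ (Fin n) →L[ℝ] EuclideanSpace ℝ (Fin n) →L[ℝ] ℝ :=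
    (S.slice p.2).inner p.1

/-- The shift at `p`, in the model space. -/
def shiftAt (p : M × ℝ) : EuclideanSpace ℝ (Fin n) := S.shift p

variable {S} {f : OpenPartialHomeomorph M (EuclideanSpace ℝ (Fin n))}

lemma isOpen_region : IsOpen S.region := isOpen_lt continuous_const continuous_snd

lemma sliceAt_symm (p : M × ℝ) (u v : EuclideanSpace ℝ (Fin n)) :
    S.sliceAt p u v = S.sliceAt p v u :=
  (S.slice p.2).symm p.1 u v

lemma sliceAt_pos (p : M × ℝ) (v : EuclideanSpace ℝ (Fin n)) (hv : v ≠ 0) : 0 < S.sliceAt p v v :=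
  (S.slice p.2).pos p.1 v hv

lemma sliceAt_nonneg (p : M × ℝ) (v : EuclideanSpace ℝ (Fin n)) : 0 ≤ S.sliceAt p v v := by
  rcases eq_or_ne v 0 with rfl | hv
  · simp
  · exact (sliceAt_pos p v hv).le

lemma metricAt_spacetimeMetric (p : M × ℝ) (u v : EuclideanSpace ℝ (Fin n) × ℝ) :
    metricAt S.spacetimeMetric p u v
      = S.sliceAt p (u.1 + u.2 • S.shiftAt p) (v.1 + v.2 • S.shiftAt p)
        - S.lapse p ^ 2 * (u.2 * v.2) :=
  rfl

lemma coordMetric_spacetimeMetric (hf : f ∈ atlas (EuclideanSpace ℝ (Fin n)) M)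
    {z : EuclideanSpace ℝ (Fin n) × ℝ}
    (hz : z.1 ∈ (f.extend (𝓡 n)).target) (u v : EuclideanSpace ℝ (Fin n) × ℝ) :
    coordMetric ((𝓡 n).prod 𝓘(ℝ, ℝ)) S.spacetimeMetric (spacetimeChart f) z u v
      = S.coordSlice f z (u.1 + u.2 • S.coordShift f z) (v.1 + v.2 • S.coordShift f z)
        - S.coordLapse f z ^ 2 * (u.2 * v.2) := by
  have hp : (f.extend (𝓡 n)).symm z.1 ∈ f.source := by
    rw [← f.extend_source (I := 𝓡 n)]; exact (f.extend (𝓡 n)).map_target hz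
  have hA : chartFrame (𝓡 n) f z.1 (S.coordShift f z)
      = S.shiftAt ((f.extend (𝓡 n)).symm z.1, z.2) := by
    have := chartFrame_chartCoframe (I := 𝓡 n) hf hp
      (S.shiftAt ((f.extend (𝓡 n)).symm z.1, z.2))
    rwa [(f.extend (𝓡 n)).right_inv hz] at this
  rw [coordMetric_apply, chartFrame_spacetimeChart hf hz, chartFrame_spacetimeChart hf hz,
    spacetimeChart_extend_symm_apply, metricAt_spacetimeMetric]
  simp only
  rw [← hA, ← map_smul, ← map_add, ← map_smul, ← map_add]
  rfl

lemma contMDiffAt_spacetimeChart_symm (hf : f ∈ atlas (EuclideanSpace ℝ (Fin n)) M)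
    {z : EuclideanSpace ℝ (Fin n) × ℝ} (hz : z.1 ∈ (f.extend (𝓡 n)).target) :
    ContMDiffAt 𝓘(ℝ, EuclideanSpace ℝ (Fin n) × ℝ) ((𝓡 n).prod 𝓘(ℝ, ℝ)) ∞
      (fun z : EuclideanSpace ℝ (Fin n) × ℝ => ((f.extend (𝓡 n)).symm z.1, z.2)) z :=
  ((contMDiffAt_extend_symm_of_mem_atlas (I := 𝓡 n) hf hz).comp z
    contDiff_fst.contMDiff.contMDiffAt).prodMk contDiff_snd.contMDiff.contMDiffAt

lemma contDiffAt_coordLapse (hf : f ∈ atlas (EuclideanSpace ℝ (Fin n)) M)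
    {z : EuclideanSpace ℝ (Fin n) × ℝ}
    (hz : z.1 ∈ (f.extend (𝓡 n)).target) (ht : S.t₀ < z.2) : ContDiffAt ℝ ∞ (S.coordLapse f) z := by
  have h1 : ContMDiffAt ((𝓡 n).prod 𝓘(ℝ, ℝ)) 𝓘(ℝ, ℝ) ∞ S.lapse
      ((f.extend (𝓡 n)).symm z.1, z.2) := S.lapse_smooth.contMDiffAt (isOpen_region.mem_nhds ht)
  exact (ContMDiffAt.comp (g := S.lapse) z h1 (contMDiffAt_spacetimeChart_symm hf hz)).contDiffAt

lemma contDiffAt_coordShift (hf : f ∈ atlas (EuclideanSpace ℝ (Fin n)) M)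
    {z : EuclideanSpace ℝ (Fin n) × ℝ}
    (hz : z.1 ∈ (f.extend (𝓡 n)).target) (ht : S.t₀ < z.2) : ContDiffAt ℝ ∞ (S.coordShift f) z := by
  have hp : (f.extend (𝓡 n)).symm z.1 ∈ f.source := by
    rw [← f.extend_source (I := 𝓡 n)]; exact (f.extend (𝓡 n)).map_target hz
  have h1 : ContMDiffAt ((𝓡 n).prod 𝓘(ℝ, ℝ)) (𝓡 n).tangent ∞
      (fun p : M × ℝ => (⟨p.1, S.shift p⟩ : TangentBundle (𝓡 n) M))
      ((f.extend (𝓡 n)).symm z.1, z.2) :=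
    S.shift_smooth.contMDiffAt (isOpen_region.mem_nhds ht)
  have h2 := ContMDiffAt.comp z h1 (contMDiffAt_spacetimeChart_symm hf hz)
  have h3 := contMDiffAt_mfderiv_apply (b := fun z : EuclideanSpace ℝ (Fin n) × ℝ =>
    (f.extend (𝓡 n)).symm z.1) (v := fun z => S.shift ((f.extend (𝓡 n)).symm z.1, z.2))
    (contMDiffAt_extend_of_mem_atlas (I := 𝓡 n) hf hp) h2
  exact ((contMDiff_snd_tangentBundle_modelSpace (EuclideanSpace ℝ (Fin n))
    𝓘(ℝ, EuclideanSpace ℝ (Fin n))).contMDiffAt.comp z h3).contDiffAt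

lemma contDiffAt_coordSlice_apply (hf : f ∈ atlas (EuclideanSpace ℝ (Fin n)) M)
    {z : EuclideanSpace ℝ (Fin n) × ℝ} (hz : z.1 ∈ (f.extend (𝓡 n)).target) (ht : S.t₀ < z.2)
    (u v : EuclideanSpace ℝ (Fin n)) : ContDiffAt ℝ ∞ (fun z => S.coordSlice f z u v) z := by
  have h1 : ContMDiffAt ((𝓡 n).prod 𝓘(ℝ, ℝ))
      ((𝓡 n).prod 𝓘(ℝ, EuclideanSpace ℝ (Fin n) →L[ℝ] EuclideanSpace ℝ (Fin n) →L[ℝ] ℝ)) ∞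
      (fun p : M × ℝ => Bundle.TotalSpace.mk'
        (EuclideanSpace ℝ (Fin n) →L[ℝ] EuclideanSpace ℝ (Fin n) →L[ℝ] ℝ)
        (E := fun x : M => TangentSpace (𝓡 n) x →L[ℝ] TangentSpace (𝓡 n) x →L[ℝ] ℝ)
        p.1 ((S.slice p.2).inner p.1)) ((f.extend (𝓡 n)).symm z.1, z.2) :=
    S.slice_smooth.contMDiffAt (isOpen_region.mem_nhds ht)
  have h2 := ContMDiffAt.comp z h1 (contMDiffAt_spacetimeChart_symm hf hz)
  have hvec : ∀ u : EuclideanSpace ℝ (Fin n),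
      ContMDiffAt 𝓘(ℝ, EuclideanSpace ℝ (Fin n) × ℝ) (𝓡 n).tangent ∞
        (fun z : EuclideanSpace ℝ (Fin n) × ℝ => (⟨(f.extend (𝓡 n)).symm z.1,
          chartFrame (𝓡 n) f z.1 u⟩ : TangentBundle (𝓡 n) M)) z := by
    intro u
    refine contMDiffAt_mfderiv_apply (b := fun z : EuclideanSpace ℝ (Fin n) × ℝ => z.1)
      (v := fun _ => u) (contMDiffAt_extend_symm_of_mem_atlas (I := 𝓡 n) hf hz) ?_
    refine Bundle.contMDiffAt_totalSpace.2 ⟨contDiff_fst.contMDiff.contMDiffAt, ?_⟩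
    convert! contMDiffAt_const (c := u) using 2 with y
    simp
  have h3 := ContMDiffAt.clm_bundle_apply₂ (F₁ := EuclideanSpace ℝ (Fin n))
    (F₂ := EuclideanSpace ℝ (Fin n)) (F₃ := ℝ) (E₃ := Bundle.Trivial M ℝ) h2 (hvec u) (hvec v)
  rw [Bundle.contMDiffAt_totalSpace] at h3
  exact h3.2.contDiffAt

lemma contDiffAt_coordSlice (hf : f ∈ atlas (EuclideanSpace ℝ (Fin n)) M)
    {z : EuclideanSpace ℝ (Fin n) × ℝ} (hz : z.1 ∈ (f.extend (𝓡 n)).target) (ht : S.t₀ < z.2) :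
    ContDiffAt ℝ ∞ (S.coordSlice f) z := by
  have hT : IsOpen {z : EuclideanSpace ℝ (Fin n) × ℝ | z.1 ∈ (f.extend (𝓡 n)).target ∧ S.t₀ < z.2}
      :=
    (f.isOpen_extend_target.preimage continuous_fst).inter
        (isOpen_lt continuous_const continuous_snd)
  refine ContDiffOn.contDiffAt ?_ (hT.mem_nhds ⟨hz, ht⟩)
  exact contDiffOn_clm_apply.2 fun u => contDiffOn_clm_apply.2 fun v z hz =>
    (contDiffAt_coordSlice_apply hf hz.1 hz.2 u v).contDiffWithinAt

lemma contDiffAt_coordMetric_spacetimeMetric (hf : f ∈ atlas (EuclideanSpace ℝ (Fin n)) M)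
    {z : EuclideanSpace ℝ (Fin n) × ℝ} (hz : z.1 ∈ (f.extend (𝓡 n)).target) (ht : S.t₀ < z.2) :
    ContDiffAt ℝ 2
      (coordMetric ((𝓡 n).prod 𝓘(ℝ, ℝ)) S.spacetimeMetric (spacetimeChart f)) z := by
  have hT : IsOpen {z : EuclideanSpace ℝ (Fin n) × ℝ | z.1 ∈ (f.extend (𝓡 n)).target ∧ S.t₀ < z.2}
      :=
    (f.isOpen_extend_target.preimage continuous_fst).inter
      (isOpen_lt continuous_const continuous_snd)
  refine ContDiffOn.contDiffAt ?_ (hT.mem_nhds ⟨hz, ht⟩)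
  refine contDiffOn_clm_apply.2 fun u => contDiffOn_clm_apply.2 fun v => ?_
  refine ContDiffOn.congr (fun z hz => ContDiffAt.contDiffWithinAt ?_)
    (fun z hz => coordMetric_spacetimeMetric hf hz.1 u v)
  have h1 := (contDiffAt_coordShift (S := S) hf hz.1 hz.2).of_le (m := 2) (by norm_cast)
  have h2 := (contDiffAt_coordSlice (S := S) hf hz.1 hz.2).of_le (m := 2) (by norm_cast)
  have h3 := (contDiffAt_coordLapse (S := S) hf hz.1 hz.2).of_le (m := 2) (by norm_cast)
  have h4 : ∀ w : EuclideanSpace ℝ (Fin n) × ℝ,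
      ContDiffAt ℝ 2 (fun z => w.1 + w.2 • S.coordShift f z) z := fun w =>
    (contDiffAt_const (c := w.1)).add (h1.const_smul w.2)
  exact ((h2.clm_apply (h4 u)).clm_apply (h4 v)).sub ((h3.pow 2).mul contDiffAt_const)

lemma spacetimeMetric_nondegenerate {p : M × ℝ} (hp : p ∈ S.region)
    {v : EuclideanSpace ℝ (Fin n) × ℝ} (hv : ∀ w, metricAt S.spacetimeMetric p v w = 0) : v = 0 :=
        by
  -- testing against a multiple of the unit normal gives the time component, testing against space
  -- vectors the space components
  have hN : S.lapse p ≠ 0 := (S.lapse_pos p hp).ne'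
  have h1 : v.2 = 0 := by
    have h := hv (-S.shiftAt p, 1)
    rw [metricAt_spacetimeMetric] at h
    simpa [hN] using h
  have h2 := hv (v.1, 0)
  rw [metricAt_spacetimeMetric] at h2
  simp only [h1, zero_smul, add_zero, mul_zero, sub_zero] at h2
  have h3 : v.1 = 0 := by
    by_contra h
    exact (sliceAt_pos p v.1 h).ne' h2
  exact Prod.ext h3 h1

lemma isPseudoMetricOn_spacetimeMetric :
    IsPseudoMetricOn ((𝓡 n).prod 𝓘(ℝ, ℝ)) S.spacetimeMetric S.region where
  symm p hp u v := by
    rw [metricAt_spacetimeMetric, metricAt_spacetimeMetric, sliceAt_symm, mul_comm u.2 v.2]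
  nondegenerate p hp v hv := spacetimeMetric_nondegenerate hp hv
  contDiffAt e he p hp hpe := by
    obtain ⟨f, hf, rfl⟩ := exists_eq_spacetimeChart he
    exact contDiffAt_coordMetric_spacetimeMetric hf
      (mem_extend_target (I := 𝓡 n) (mem_spacetimeChart_source.1 hpe)) hp

end SplitSpacetime

/-! ### Evolution of the energy along a geodesic -/

section SplitCoordinates

variable {V : Type*} [NormedAddCommGroup V] [NormedSpace ℝ V]
  {g : V × ℝ → V × ℝ →L[ℝ] V × ℝ →L[ℝ] ℝ} {h : V × ℝ → V →L[ℝ] V →L[ℝ] ℝ} {β : V × ℝ → V}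
  {N : V × ℝ → ℝ} {z : V × ℝ}

lemma hasFDerivAt_apply_apply (hg : DifferentiableAt ℝ g z) (v w : V × ℝ) :
    HasFDerivAt (fun z => g z v w) (((fderiv ℝ g z).flip v).flip w) z := by
  convert! (hg.hasFDerivAt.clm_apply (hasFDerivAt_const v z)).clm_apply (hasFDerivAt_const w z)
    using 1
  ext <;> simp

/-- For a metric in `n + 1` form, the derivative of `g(ν, ν)`, where `ν` is the vector with
constant coordinates equal to the unit normal at `z`: the shift does not contribute, because it
enters through the square of a quantity vanishing at `z`. -/
lemma fderiv_normal_normal (hg : DifferentiableAt ℝ g z) (hh : DifferentiableAt ℝ h z)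
    (hβ : DifferentiableAt ℝ β z) (hN : DifferentiableAt ℝ N z) (hN0 : N z ≠ 0)
    (heq : ∀ᶠ y in 𝓝 z, ∀ u v : V × ℝ,
      g y u v = h y (u.1 + u.2 • β y) (v.1 + v.2 • β y) - N y ^ 2 * (u.2 * v.2))
    (u : V × ℝ) :
    fderiv ℝ g z u (-((N z)⁻¹ • β z), (N z)⁻¹) (-((N z)⁻¹ • β z), (N z)⁻¹)
      = -(2 * fderiv ℝ N z u / N z) := by
  set ν : V × ℝ := (-((N z)⁻¹ • β z), (N z)⁻¹) with hν
  have h1 := hasFDerivAt_apply_apply hg ν ν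
  have h2 : HasFDerivAt (fun y => ν.1 + ν.2 • β y) (ν.2 • fderiv ℝ β z) z :=
    (hβ.hasFDerivAt.const_smul ν.2).const_add ν.1
  have h3 := ((hh.hasFDerivAt.clm_apply h2).clm_apply h2).sub
    ((hN.hasFDerivAt.pow 2).mul_const (ν.2 * ν.2))
  have h4 := h1.unique (h3.congr_of_eventuallyEq (heq.mono fun y hy => hy ν ν))
  have h5 := congrArg (fun L : V × ℝ →L[ℝ] ℝ => L u) h4
  have h6 : ν.1 + ν.2 • β z = 0 := by simp [hν]
  simp [h6] at h5
  rw [h5]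
  simp only [hν]
  field_simp

/-- Evolution of the energy of a geodesic with respect to the normal observers, in coordinates.
The normal at `x s` is extended as a constant vector `ν`, and the term `∂_u G(ν, ν)` of the
Christoffel symbol accounts for the derivative of the lapse. -/
lemma GeodesicEqAt.hasDerivAt_energy {x : ℝ → V × ℝ} {s : ℝ} (hgeo : GeodesicEqAt g x s)
    (hx : ContDiffAt ℝ 2 x s)
    (hg : DifferentiableAt ℝ g (x s)) (hh : DifferentiableAt ℝ h (x s))
    (hβ : DifferentiableAt ℝ β (x s)) (hN : DifferentiableAt ℝ N (x s)) (hN0 : N (x s) ≠ 0)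
    (hsymm : ∀ᶠ y in 𝓝 (x s), ∀ u v, g y u v = g y v u)
    (heq : ∀ᶠ y in 𝓝 (x s), ∀ u v : V × ℝ,
      g y u v = h y (u.1 + u.2 • β y) (v.1 + v.2 • β y) - N y ^ 2 * (u.2 * v.2))
    {w : V} (hw : w = (deriv x s).1 + (deriv x s).2 • β (x s)) :
    HasDerivAt (fun s => N (x s) * (deriv x s).2)
      (coordChristoffel g (x s) (w, 0) (w, 0) (-((N (x s))⁻¹ • β (x s)), (N (x s))⁻¹)
        - (deriv x s).2 * fderiv ℝ N (x s) (w, 0)) s := by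
  have h1 : HasDerivAt x (deriv x s) s := (hx.differentiableAt (by norm_num)).hasDerivAt
  have h2 : HasDerivAt (fun s => (deriv x s).2) (deriv (deriv x) s).2 s := hx.hasDerivAt_deriv.snd
  have h3 : HasDerivAt (fun s => N (x s)) (fderiv ℝ N (x s) (deriv x s)) s :=
    HasFDerivAt.comp_hasDerivAt (l := N) s hN.hasFDerivAt h1
  refine (h3.mul h2).congr_deriv ?_
  have hνν := fderiv_normal_normal hg hh hβ hN hN0 heq
  set ν : V × ℝ := (-((N (x s))⁻¹ • β (x s)), (N (x s))⁻¹) with hν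
  set u := deriv x s with hu
  -- the geodesic equation, tested against the normal
  have h4 := hgeo ν
  rw [heq.self_of_nhds] at h4
  have h5 : ν.1 + ν.2 • β (x s) = 0 := by simp [hν]
  rw [h5, map_zero] at h4
  have h6 : N (x s) * (deriv (deriv x) s).2 = coordChristoffel g (x s) u u ν := by
    have : N (x s) ^ 2 * ((deriv (deriv x) s).2 * ν.2) = N (x s) * (deriv (deriv x) s).2 := by
      simp only [hν]; field_simp
    rw [this] at h4
    linarith
  -- decomposition of the velocity into normal and spatial parts
  have hdec : u = (N (x s) * u.2) • ν + (w, 0) := by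
    refine Prod.ext ?_ ?_
    · simp only [Prod.fst_add, Prod.smul_fst, hν, hw, smul_neg, smul_smul]
      rw [mul_right_comm, mul_inv_cancel₀ hN0, one_mul]
      abel
    · simp only [Prod.snd_add, Prod.smul_snd, hν, smul_eq_mul, add_zero]
      field_simp
  have hsy : ∀ a b c : V × ℝ, fderiv ℝ g (x s) a b c = fderiv ℝ g (x s) a c b := by
    intro a b c
    have e1 := hasFDerivAt_apply_apply hg b c
    have e2 := hasFDerivAt_apply_apply hg c b
    have e3 := e1.unique (e2.congr_of_eventuallyEq (hsymm.mono fun y hy => hy b c))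
    simpa using congrArg (fun L : V × ℝ →L[ℝ] ℝ => L a) e3
  rw [h6]
  generalize hE : N (x s) * u.2 = E at hdec
  have hu2 : u.2 = E / N (x s) := by rw [← hE]; field_simp
  rw [hu2]
  conv_lhs => rw [hdec]
  simp only [coordChristoffel, map_add, map_smul, _root_.add_apply, _root_.smul_apply, smul_eq_mul,
    hνν, hsy ν (w, 0) ν]
  rw [hsy (w, 0) (w, 0) ν]
  field_simp
  ring

end SplitCoordinates

section PreferredChart

variable {E : Type*} [NormedAddCommGroup E] [NormedSpace ℝ E]
  {H : Type*} [TopologicalSpace H] {I : ModelWithCorners ℝ E H} [I.Boundaryless]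
  {X : Type*} [TopologicalSpace X] [ChartedSpace H X] [IsManifold I ∞ X]

omit [I.Boundaryless] [IsManifold I ∞ X] in
lemma chartCoframe_chartAt (p : X) (v : E) : chartCoframe I (chartAt H p) p v = v := by
  have h : HasMFDerivAt I 𝓘(ℝ, E) (extChartAt I p) p (ContinuousLinearMap.id ℝ E) := by
    refine ⟨continuousAt_extChartAt p, ?_⟩
    have h1 : writtenInExtChartAt I 𝓘(ℝ, E) p (extChartAt I p) =ᶠ[𝓝[range I] (extChartAt I p p)]
        id := by
      filter_upwards [extChartAt_target_mem_nhdsWithin (I := I) p] with y hy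
      exact (extChartAt I p).right_inv hy
    exact (hasFDerivWithinAt_id _ _).congr_of_eventuallyEq h1
      (h1.eq_of_nhdsWithin (mem_range_self _))
  exact congrArg (fun L : E →L[ℝ] E => L v) h.mfderiv

lemma chartFrame_chartAt (p : X) (v : E) :
    chartFrame I (chartAt H p) ((chartAt H p).extend I p) v = v := by
  have h1 := chartFrame_chartCoframe (I := I) (chart_mem_atlas H p) (mem_chart_source H p) v
  rwa [chartCoframe_chartAt] at h1

end PreferredChart

namespace SplitSpacetime

variable {n : ℕ} {M : Type*} [TopologicalSpace M] [ChartedSpace (EuclideanSpace ℝ (Fin n)) M]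
  [IsManifold (𝓡 n) ∞ M] (S : SplitSpacetime n M)

/-- The energy `-G(c', ν) = N t'` of a curve with respect to the observers normal to the slices. -/
def energy (c : ℝ → M × ℝ) (s : ℝ) : ℝ :=
  S.lapse (c s) * (curveVelocity ((𝓡 n).prod 𝓘(ℝ, ℝ)) c s).2

/-- The part `x' + t' β` of the velocity of a curve which is tangent to the slices, in its
decomposition along the slices and their normal. -/
def spatialVelocity (c : ℝ → M × ℝ) (s : ℝ) : EuclideanSpace ℝ (Fin n) :=
  (curveVelocity ((𝓡 n).prod 𝓘(ℝ, ℝ)) c s).1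
    + (curveVelocity ((𝓡 n).prod 𝓘(ℝ, ℝ)) c s).2 • S.shiftAt (c s)

variable {S}

lemma coordLapse_chartAt (p : M × ℝ) (f : OpenPartialHomeomorph M (EuclideanSpace ℝ (Fin n)))
    (hp : p.1 ∈ f.source) : S.coordLapse f (f.extend (𝓡 n) p.1, p.2) = S.lapse p := by
  simp only [coordLapse]
  rw [extend_left_inv' hp]

lemma coordShift_chartAt (p : M × ℝ) :
    S.coordShift (chartAt (EuclideanSpace ℝ (Fin n)) p.1)
      ((chartAt (EuclideanSpace ℝ (Fin n)) p.1).extend (𝓡 n) p.1, p.2) = S.shiftAt p := by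
  have key : ∀ q : M × ℝ, q = p → chartCoframe (𝓡 n) (chartAt (EuclideanSpace ℝ (Fin n)) p.1) q.1
      (S.shiftAt q) = S.shiftAt p := by
    rintro _ rfl
    exact chartCoframe_chartAt _ _
  have hq : ((((chartAt (EuclideanSpace ℝ (Fin n)) p.1).extend (𝓡 n)).symm
      ((chartAt (EuclideanSpace ℝ (Fin n)) p.1).extend (𝓡 n) p.1), p.2) : M × ℝ) = p := by
    rw [extend_left_inv' (mem_chart_source _ p.1)]
  exact key _ hq

lemma dLapse_eq_fderiv {p : M × ℝ} (hp : p ∈ S.region) (i : Fin n) :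
    S.dLapse p i = fderiv ℝ (S.coordLapse (chartAt (EuclideanSpace ℝ (Fin n)) p.1))
      ((chartAt (EuclideanSpace ℝ (Fin n)) p.1).extend (𝓡 n) p.1, p.2)
      (EuclideanSpace.single i (1 : ℝ), 0) := by
  set f := chartAt (EuclideanSpace ℝ (Fin n)) p.1 with hf
  have hfa : f ∈ atlas (EuclideanSpace ℝ (Fin n)) M := chart_mem_atlas _ _
  have hpf : p.1 ∈ f.source := mem_chart_source _ _
  have h1 : HasFDerivAt (S.coordLapse f) _ (f.extend (𝓡 n) p.1, p.2) :=
    ((contDiffAt_coordLapse (S := S) (z := (f.extend (𝓡 n) p.1, p.2)) hfa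
      (mem_extend_target (I := 𝓡 n) hpf) hp).differentiableAt (by simp)).hasFDerivAt
  have h2 : HasFDerivAt (fun y => S.coordLapse f (y, p.2)) _ (f.extend (𝓡 n) p.1) :=
    HasFDerivAt.comp (g := S.coordLapse f) (f.extend (𝓡 n) p.1) h1 (hasFDerivAt_prodMk_left _ p.2)
  have h3 := ((contMDiffAt_extend_of_mem_atlas (I := 𝓡 n) hfa hpf).mdifferentiableAt
    (by simp)).hasMFDerivAt
  have h4 := HasMFDerivAt.comp p.1 h2.hasMFDerivAt h3
  have h5 : HasMFDerivAt (𝓡 n) 𝓘(ℝ, ℝ) (fun x : M => S.lapse (x, p.2)) p.1 _ :=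
    h4.congr_of_eventuallyEq (by
      filter_upwards [f.open_source.mem_nhds hpf] with x hx
      exact (coordLapse_chartAt (x, p.2) f hx).symm)
  rw [dLapse, h5.mfderiv]
  have h6 : chartCoframe (𝓡 n) f p.1 (EuclideanSpace.single i (1 : ℝ))
      = EuclideanSpace.single i (1 : ℝ) := chartCoframe_chartAt p.1 _
  exact congrArg (fun v => fderiv ℝ (S.coordLapse f) (f.extend (𝓡 n) p.1, p.2) (v, 0)) h6

lemma coordChristoffel_sum {V ι : Type*} [NormedAddCommGroup V] [NormedSpace ℝ V] [Fintype ι]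
    (g : V → V →L[ℝ] V →L[ℝ] ℝ) (z ν : V) (a : ι → ℝ) (u : ι → V) :
    coordChristoffel g z (∑ i, a i • u i) (∑ i, a i • u i) ν
      = ∑ i, ∑ j, coordChristoffel g z (u i) (u j) ν * a i * a j := by
  have h1 : fderiv ℝ g z (∑ i, a i • u i) (∑ i, a i • u i) ν
      = ∑ i, ∑ j, a i * a j * fderiv ℝ g z (u i) (u j) ν := by
    simp only [map_sum, map_smul, _root_.sum_apply, _root_.smul_apply, smul_eq_mul, Finset.mul_sum]
    rw [Finset.sum_comm]
    exact Finset.sum_congr rfl fun i _ => Finset.sum_congr rfl fun j _ => by ring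
  have h2 : fderiv ℝ g z ν (∑ i, a i • u i) (∑ i, a i • u i)
      = ∑ i, ∑ j, a i * a j * fderiv ℝ g z ν (u i) (u j) := by
    simp only [map_sum, map_smul, _root_.sum_apply, _root_.smul_apply, smul_eq_mul, Finset.mul_sum]
    rw [Finset.sum_comm]
    exact Finset.sum_congr rfl fun i _ => Finset.sum_congr rfl fun j _ => by ring
  have h3 : ∑ i, ∑ j, a i * a j * fderiv ℝ g z (u i) (u j) ν
      = ∑ i, ∑ j, a i * a j * fderiv ℝ g z (u j) (u i) ν := by
    rw [Finset.sum_comm]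
    simp only [mul_comm]
  rw [coordChristoffel, h1, h2]
  nth_rewrite 2 [h3]
  simp only [coordChristoffel, ← Finset.sum_add_distrib, ← Finset.sum_sub_distrib, Finset.mul_sum]
  refine Finset.sum_congr rfl fun i _ => Finset.sum_congr rfl fun j _ => ?_
  ring

lemma prodMk_zero_eq_sum (w : EuclideanSpace ℝ (Fin n)) :
    ((w, 0) : EuclideanSpace ℝ (Fin n) × ℝ)
      = ∑ i, w i • ((EuclideanSpace.single i (1 : ℝ), 0) : EuclideanSpace ℝ (Fin n) × ℝ) := by
  have h1 : w = ∑ i, w i • EuclideanSpace.single i (1 : ℝ) := by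
    ext j
    simp [Pi.single_apply]
  refine Prod.ext ?_ ?_
  · rw [Prod.fst_sum]; exact h1
  · rw [Prod.snd_sum]; simp

/-- Evolution of the energy along a geodesic: `E' = K(w, w) - t' dN(w)`. -/
lemma hasDerivAt_energy {c : ℝ → M × ℝ} {s : ℝ}
    (hgeo : IsGeodesicAt ((𝓡 n).prod 𝓘(ℝ, ℝ)) S.spacetimeMetric c s)
    (hc : ∀ᶠ r in 𝓝 s, ContMDiffAt 𝓘(ℝ, ℝ) ((𝓡 n).prod 𝓘(ℝ, ℝ)) 1 c r) (hp : c s ∈ S.region) :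
    HasDerivAt (S.energy c)
      (∑ i, ∑ j, S.extrinsicCurvature (c s) i j * S.spatialVelocity c s i * S.spatialVelocity c s j
        - (curveVelocity ((𝓡 n).prod 𝓘(ℝ, ℝ)) c s).2
          * ∑ i, S.dLapse (c s) i * S.spatialVelocity c s i) s := by
  set p := c s with hpdef
  set f := chartAt (EuclideanSpace ℝ (Fin n)) p.1 with hf
  have hfa : f ∈ atlas (EuclideanSpace ℝ (Fin n)) M := chart_mem_atlas _ _
  have hpf : p.1 ∈ f.source := mem_chart_source _ _
  have he := spacetimeChart_mem_atlas hfa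
  set x := (spacetimeChart f).extend ((𝓡 n).prod 𝓘(ℝ, ℝ)) ∘ c with hx
  have hxs : x s = (f.extend (𝓡 n) p.1, p.2) := rfl
  have hsrc : c s ∈ (spacetimeChart f).source := mem_spacetimeChart_source.2 hpf
  have htgt : (x s).1 ∈ (f.extend (𝓡 n)).target := mem_extend_target hpf
  have hx2 : ContDiffAt ℝ 2 x s := contDiffAt_extend_comp he hsrc (by norm_cast) hgeo.1
  have hvel : ∀ᶠ r in 𝓝 s, curveVelocity ((𝓡 n).prod 𝓘(ℝ, ℝ)) c r
      = (chartFrame (𝓡 n) f (x r).1 (deriv x r).1, (deriv x r).2) ∧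
      S.coordLapse f (x r) = S.lapse (c r) := by
    filter_upwards [hc, hgeo.1.continuousAt.preimage_mem_nhds
      ((spacetimeChart f).open_source.mem_nhds hsrc)] with r hr hrs
    have hrf : (c r).1 ∈ f.source := mem_spacetimeChart_source.1 hrs
    refine ⟨?_, coordLapse_chartAt (c r) f hrf⟩
    rw [mfderiv_eq_chartFrame he hrs hr]
    exact chartFrame_spacetimeChart hfa (mem_extend_target hrf) _
  have hvs : curveVelocity ((𝓡 n).prod 𝓘(ℝ, ℝ)) c s = deriv x s := by
    rw [hvel.self_of_nhds.1]
    exact Prod.ext (chartFrame_chartAt p.1 _) rfl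
  have hten : ∀ᶠ y in 𝓝 (x s), y.1 ∈ (f.extend (𝓡 n)).target ∧ S.t₀ < y.2 :=
    ((f.isOpen_extend_target.preimage continuous_fst).inter
      (isOpen_lt continuous_const continuous_snd)).mem_nhds ⟨htgt, hp⟩
  have hNs : S.coordLapse f (x s) = S.lapse p := hvel.self_of_nhds.2
  have hβs : S.coordShift f (x s) = S.shiftAt p := coordShift_chartAt p
  have hw : S.spatialVelocity c s = (deriv x s).1 + (deriv x s).2 • S.coordShift f (x s) := by
    rw [spatialVelocity, hvs, hβs]
  have key := (hgeo.2 _ he hsrc).hasDerivAt_energy (h := S.coordSlice f) (β := S.coordShift f)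
    (N := S.coordLapse f) hx2
    ((contDiffAt_coordMetric_spacetimeMetric hfa htgt hp).differentiableAt (by norm_num))
    ((contDiffAt_coordSlice hfa htgt hp).differentiableAt (by simp))
    ((contDiffAt_coordShift hfa htgt hp).differentiableAt (by simp))
    ((contDiffAt_coordLapse hfa htgt hp).differentiableAt (by simp))
    (by
      show S.coordLapse f (x s) ≠ 0
      rw [hNs]; exact (S.lapse_pos p hp).ne')
    (hten.mono fun y hy => isPseudoMetricOn_spacetimeMetric.coordMetric_symm
      (by rw [spacetimeChart_extend_symm_apply]; exact hy.2))
    (hten.mono fun y hy => coordMetric_spacetimeMetric hfa hy.1) hw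
  have hfun : S.energy c =ᶠ[𝓝 s] fun s => S.coordLapse f (x s) * (deriv x s).2 :=
    hvel.mono fun r hr => by
      show _ = S.coordLapse f (x r) * (deriv x r).2
      rw [energy, hr.1, hr.2]
  refine (key.congr_of_eventuallyEq hfun).congr_deriv ?_
  rw [hvs]
  congr 1
  · rw [prodMk_zero_eq_sum, coordChristoffel_sum]
    have hν : (-((S.coordLapse f (x s))⁻¹ • S.coordShift f (x s)), (S.coordLapse f (x s))⁻¹)
        = S.normal p := by rw [hNs, hβs]; rfl
    show ∑ i, ∑ j, coordChristoffel _ (x s) _ _ (-((S.coordLapse f (x s))⁻¹ • S.coordShift f (x s)),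
      (S.coordLapse f (x s))⁻¹) * _ * _ = _
    rw [hν]
    rfl
  · congr 1
    rw [prodMk_zero_eq_sum, map_sum]
    refine Finset.sum_congr rfl fun i _ => ?_
    rw [map_smul, smul_eq_mul, mul_comm, dLapse_eq_fderiv hp]
    rfl

end SplitSpacetime

/-! ### Pointwise estimate of the energy derivative -/

section LinearAlgebra

open Matrix
open scoped Kronecker

lemma Matrix.dotProduct_mulVec_eq_sum {ι : Type*} [Fintype ι] (A : Matrix ι ι ℝ) (v w : ι → ℝ) :
    v ⬝ᵥ A *ᵥ w = ∑ i, ∑ j, A i j * v i * w j := by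
  simp only [dotProduct, mulVec, Finset.mul_sum]
  exact Finset.sum_congr rfl fun i _ => Finset.sum_congr rfl fun j _ => by ring

/-- Cauchy--Schwarz for a covector and a vector. -/
lemma Matrix.PosDef.abs_sum_mul_le {ι : Type*} [Fintype ι] [DecidableEq ι] {g : Matrix ι ι ℝ}
    (hg : g.PosDef) (d w : ι → ℝ) :
    |∑ i, d i * w i| ≤ Real.sqrt (∑ i, ∑ j, g⁻¹ i j * d i * d j)
      * Real.sqrt (∑ i, ∑ j, g i j * w i * w j) := by
  have hgi : g⁻¹ * g = 1 := Matrix.nonsing_inv_mul _ ((Matrix.isUnit_iff_isUnit_det _).1 hg.isUnit)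
  have hgi' : g * g⁻¹ = 1 := Matrix.mul_nonsing_inv _ ((Matrix.isUnit_iff_isUnit_det _).1 hg.isUnit)
  have hsymm : gᵀ = g := by simpa using hg.isHermitian.eq
  have hisymm : (g⁻¹)ᵀ = g⁻¹ := by rw [Matrix.transpose_nonsing_inv, hsymm]
  have hnn : ∀ x : ι → ℝ, 0 ≤ x ⬝ᵥ g *ᵥ x := fun x => by
    simpa using hg.posSemidef.dotProduct_mulVec_nonneg x
  have hcs := LinearMap.BilinForm.apply_sq_le_of_symm (Matrix.toBilin' g)
    (fun x => by rw [Matrix.toBilin'_apply']; exact hnn x)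
    ⟨fun x y => by
      simp only [Matrix.toBilin'_apply', RingHom.id_apply]
      rw [dotProduct_mulVec, ← mulVec_transpose, hsymm, dotProduct_comm]⟩ (g⁻¹ *ᵥ d) w
  simp only [Matrix.toBilin'_apply'] at hcs
  have h1 : (g⁻¹ *ᵥ d) ⬝ᵥ g *ᵥ w = ∑ i, d i * w i := by
    rw [dotProduct_comm, dotProduct_mulVec, ← mulVec_transpose, hisymm, mulVec_mulVec, hgi,
        one_mulVec,
      dotProduct_comm]
    rfl
  have h2 : (g⁻¹ *ᵥ d) ⬝ᵥ g *ᵥ (g⁻¹ *ᵥ d) = ∑ i, ∑ j, g⁻¹ i j * d i * d j := by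
    rw [mulVec_mulVec, hgi', one_mulVec, dotProduct_comm, dotProduct_mulVec_eq_sum]
  rw [h1, h2, dotProduct_mulVec_eq_sum] at hcs
  have h3 : 0 ≤ ∑ i, ∑ j, g⁻¹ i j * d i * d j := by rw [← h2]; exact hnn _
  rw [← Real.sqrt_mul h3]
  exact Real.abs_le_sqrt hcs

/-- `|P(w, w)| ≤ |P| |w|²`: this is the Cauchy--Schwarz inequality for the tensors `P` and
`w ⊗ w`. -/
lemma Matrix.PosDef.abs_quadratic_le {ι : Type*} [Fintype ι] [DecidableEq ι] {g : Matrix ι ι ℝ}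
    (hg : g.PosDef) (P : Matrix ι ι ℝ) (w : ι → ℝ) :
    |∑ i, ∑ j, P i j * w i * w j|
      ≤ Real.sqrt (∑ i, ∑ j, ∑ k, ∑ l, g⁻¹ i k * g⁻¹ j l * P i j * P k l)
        * ∑ i, ∑ j, g i j * w i * w j := by
  have h := (hg.kronecker hg).abs_sum_mul_le (fun p => P p.1 p.2) (fun p => w p.1 * w p.2)
  rw [Matrix.inv_kronecker] at h
  simp only [Fintype.sum_prod_type, kroneckerMap_apply, ← mul_assoc] at h
  have hnn : 0 ≤ ∑ i, ∑ j, g i j * w i * w j := by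
    rw [← dotProduct_mulVec_eq_sum]
    simpa using hg.posSemidef.dotProduct_mulVec_nonneg w
  have h1 : ∑ i, ∑ j, ∑ k, ∑ l, g i k * g j l * w i * w j * w k * w l
      = (∑ i, ∑ j, g i j * w i * w j) ^ 2 := by
    rw [sq, Finset.sum_mul_sum]
    refine Finset.sum_congr rfl fun i _ => Finset.sum_congr rfl fun j _ => ?_
    rw [Finset.sum_mul_sum]
    exact Finset.sum_congr rfl fun k _ => Finset.sum_congr rfl fun l _ => by ring
  rwa [h1, Real.sqrt_sq hnn] at h

end LinearAlgebra

namespace SplitSpacetime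

variable {n : ℕ} {M : Type*} [TopologicalSpace M] [ChartedSpace (EuclideanSpace ℝ (Fin n)) M]
  [IsManifold (𝓡 n) ∞ M] {S : SplitSpacetime n M}

lemma sliceAt_eq_sum (p : M × ℝ) (w : EuclideanSpace ℝ (Fin n)) :
    S.sliceAt p w w = ∑ i, ∑ j, S.gMat p i j * w i * w j := by
  have h1 : w = ∑ i, w i • EuclideanSpace.single i (1 : ℝ) := by
    ext j
    simp [Pi.single_apply]
  conv_lhs => rw [h1]
  simp only [map_sum, map_smul, _root_.sum_apply, _root_.smul_apply, smul_eq_mul, Finset.mul_sum]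
  rw [Finset.sum_comm]
  refine Finset.sum_congr rfl fun i _ => Finset.sum_congr rfl fun j _ => ?_
  have : S.gMat p i j = S.sliceAt p (EuclideanSpace.single i (1 : ℝ))
    (EuclideanSpace.single j (1 : ℝ)) := rfl
  rw [this]
  ring

lemma posDef_gMat (p : M × ℝ) : (S.gMat p).PosDef := by
  refine Matrix.PosDef.of_dotProduct_mulVec_pos ?_ fun {w} hw => ?_
  · ext i j
    exact sliceAt_symm (S := S) p _ _
  · have h1 := sliceAt_eq_sum (S := S) p (WithLp.toLp 2 w)
    rw [star_trivial, Matrix.dotProduct_mulVec_eq_sum]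
    rw [← h1]
    exact sliceAt_pos p _ (by simpa using hw)

/-- In an expanding spacetime, the energy of a causal geodesic grows at most at the rate
`N |P| + |∇N|` with respect to `t`. -/
lemma energy_deriv_le {c : ℝ → M × ℝ} {s : ℝ} (hp : c s ∈ S.region)
    (hexp : S.meanCurvature (c s) ≤ 0)
    (hpos : 0 < (curveVelocity ((𝓡 n).prod 𝓘(ℝ, ℝ)) c s).2)
    (hcausal : metricAt S.spacetimeMetric (c s) (curveVelocity ((𝓡 n).prod 𝓘(ℝ, ℝ)) c s)
      (curveVelocity ((𝓡 n).prod 𝓘(ℝ, ℝ)) c s) ≤ 0) :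
    ∑ i, ∑ j, S.extrinsicCurvature (c s) i j * S.spatialVelocity c s i * S.spatialVelocity c s j
        - (curveVelocity ((𝓡 n).prod 𝓘(ℝ, ℝ)) c s).2
          * ∑ i, S.dLapse (c s) i * S.spatialVelocity c s i
      ≤ S.energy c s * ((curveVelocity ((𝓡 n).prod 𝓘(ℝ, ℝ)) c s).2 *
        (S.normGradLapse (c s) + S.lapse (c s) * S.normTracelessPart (c s))) := by
  set p := c s
  set u := curveVelocity ((𝓡 n).prod 𝓘(ℝ, ℝ)) c s with hu
  set w := S.spatialVelocity c s with hw
  have hN : 0 < S.lapse p := S.lapse_pos p hp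
  have hE : S.energy c s = S.lapse p * u.2 := rfl
  have hE0 : 0 < S.lapse p * u.2 := mul_pos hN hpos
  have hw2 : S.sliceAt p w w ≤ (S.lapse p * u.2) ^ 2 := by
    rw [metricAt_spacetimeMetric] at hcausal
    have : S.sliceAt p w w - S.lapse p ^ 2 * (u.2 * u.2) ≤ 0 := hcausal
    nlinarith
  have hw0 := sliceAt_nonneg (S := S) p w
  have h1 := (posDef_gMat (S := S) p).abs_sum_mul_le (S.dLapse p) w
  have h2 := (posDef_gMat (S := S) p).abs_quadratic_le (S.tracelessPart p) w
  rw [← sliceAt_eq_sum] at h1 h2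
  have hgr : 0 ≤ S.normGradLapse p := Real.sqrt_nonneg _
  have htr : 0 ≤ S.normTracelessPart p := Real.sqrt_nonneg _
  have h3 : |∑ i, S.dLapse p i * w i| ≤ S.normGradLapse p * (S.lapse p * u.2) :=
    h1.trans (mul_le_mul_of_nonneg_left (Real.sqrt_le_iff.2 ⟨hE0.le, hw2⟩) hgr)
  have h4 : |∑ i, ∑ j, S.tracelessPart p i j * w i * w j|
      ≤ S.normTracelessPart p * (S.lapse p * u.2) ^ 2 :=
    h2.trans (mul_le_mul_of_nonneg_left hw2 htr)
  -- `K = P + (τ / n) g`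
  have h5 : ∑ i, ∑ j, S.extrinsicCurvature p i j * w i * w j
      = ∑ i, ∑ j, S.tracelessPart p i j * w i * w j + S.meanCurvature p / n * S.sliceAt p w w := by
    rw [sliceAt_eq_sum, Finset.mul_sum, ← Finset.sum_add_distrib]
    refine Finset.sum_congr rfl fun i _ => ?_
    rw [Finset.mul_sum, ← Finset.sum_add_distrib]
    refine Finset.sum_congr rfl fun j _ => ?_
    simp only [tracelessPart, Matrix.sub_apply, Matrix.smul_apply, smul_eq_mul]
    ring
  -- for `n = 0` the quotient is `0`, which does no harm
  have h6 : S.meanCurvature p / n * S.sliceAt p w w ≤ 0 :=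
    mul_nonpos_of_nonpos_of_nonneg (div_nonpos_of_nonpos_of_nonneg hexp (Nat.cast_nonneg n)) hw0
  have h7 : -(u.2 * ∑ i, S.dLapse p i * w i) ≤ u.2 * (S.normGradLapse p * (S.lapse p * u.2)) := by
    rw [← mul_neg]
    exact mul_le_mul_of_nonneg_left ((neg_le_abs _).trans h3) hpos.le
  rw [h5, hE]
  have h8 := (le_abs_self _).trans h4
  linarith

end SplitSpacetime

/-! ### Bounds along causal geodesics and extension past a finite parameter -/

/-- A Grönwall estimate: if the logarithmic derivative of a positive function `y` is at most
`t' φ(t)` for an increasing function `t` and an integrable function `φ`, then `y` is bounded. -/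
lemma exists_bound_of_deriv_le {y y' t t' φ : ℝ → ℝ} {a b : ℝ} (hab : a < b)
    (hy : ∀ s ∈ Ico a b, HasDerivAt y (y' s) s) (hpos : ∀ s ∈ Ico a b, 0 < y s)
    (ht : ∀ s ∈ Ico a b, HasDerivAt t (t' s) s) (htpos : ∀ s ∈ Ico a b, 0 < t' s)
    (hφ : IntegrableOn φ (Ici (t a)))
    (hle : ∀ s ∈ Ico a b, y' s ≤ y s * (t' s * φ (t s))) :
    ∃ C, 0 < C ∧ ∀ s ∈ Ico a b, y s ≤ C := by
  refine ⟨y a * Real.exp (∫ r in Ici (t a), |φ r|), mul_pos (hpos a ⟨le_rfl, hab⟩)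
    (Real.exp_pos _), fun s hs => ?_⟩
  have hsub : Icc a s ⊆ Ico a b := fun r hr => ⟨hr.1, hr.2.trans_lt hs.2⟩
  have hmono : StrictMonoOn t (Icc a s) :=
    strictMonoOn_of_hasDerivWithinAt_pos (convex_Icc a s)
      (fun r hr => (ht r (hsub hr)).continuousAt.continuousWithinAt)
      (fun r hr => (ht r (hsub (interior_subset hr))).hasDerivWithinAt)
      (fun r hr => htpos r (hsub (interior_subset hr)))
  have himg : t '' Icc a s ⊆ Ici (t a) := by
    rintro _ ⟨r, hr, rfl⟩
    exact hmono.monotoneOn ⟨le_rfl, hs.1⟩ hr hr.1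
  have hφ' : IntegrableOn (fun r => |φ r|) (Ici (t a)) := hφ.abs
  have hder : ∀ r ∈ Icc a s, HasDerivWithinAt t (t' r) (Icc a s) r :=
    fun r hr => (ht r (hsub hr)).hasDerivWithinAt
  have hint := (integrableOn_image_iff_integrableOn_abs_deriv_smul measurableSet_Icc hder
    hmono.injOn (fun r => |φ r|)).1 (hφ'.mono_set himg)
  have hval := integral_image_eq_integral_abs_deriv_smul measurableSet_Icc hder
    hmono.injOn (fun r => |φ r|)
  have hlog : Real.log (y s) - Real.log (y a)
      ≤ ∫ r in a..s, |t' r| • |φ (t r)| := by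
    refine intervalIntegral.sub_le_integral_of_hasDeriv_right_of_le
      (g := fun r => Real.log (y r)) (g' := fun r => y' r / y r) hs.1
      (fun r hr => ?_) (fun r hr => ?_) hint (fun r hr => ?_)
    · exact ((hy r (hsub hr)).log (hpos r (hsub hr)).ne').continuousAt.continuousWithinAt
    · have hr' := hsub (Ioo_subset_Icc_self hr)
      exact ((hy r hr').log (hpos r hr').ne').hasDerivWithinAt
    · have hr' := hsub (Ioo_subset_Icc_self hr)
      rw [div_le_iff₀ (hpos r hr'), smul_eq_mul, abs_of_pos (htpos r hr'), mul_comm _ (y r)]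
      exact (hle r hr').trans (mul_le_mul_of_nonneg_left
        (mul_le_mul_of_nonneg_left (le_abs_self _) (htpos r hr').le) (hpos r hr').le)
  rw [intervalIntegral.integral_of_le hs.1, ← integral_Icc_eq_integral_Ioc, ← hval] at hlog
  have hle2 := hlog.trans (setIntegral_mono_set hφ' (Eventually.of_forall fun r => abs_nonneg _)
    himg.eventuallyLE)
  have hya := hpos a ⟨le_rfl, hab⟩
  rw [← Real.log_le_log_iff (hpos s hs) (mul_pos hya (Real.exp_pos _)),
    Real.log_mul hya.ne' (Real.exp_pos _).ne', Real.log_exp]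
  linarith

/-- A positive definite form on a finite dimensional space dominates the norm, uniformly for nearby
forms. -/
lemma exists_eventually_mul_sq_le {V Z : Type*} [NormedAddCommGroup V] [NormedSpace ℝ V]
    [FiniteDimensional ℝ V] [TopologicalSpace Z] {h : Z → V →L[ℝ] V →L[ℝ] ℝ} {z₀ : Z}
    (hcont : ContinuousAt h z₀) (hpos : ∀ v, v ≠ 0 → 0 < h z₀ v v) :
    ∃ δ > 0, ∀ᶠ z in 𝓝 z₀, ∀ v, δ * ‖v‖ ^ 2 ≤ h z v v := by
  have : ProperSpace V := FiniteDimensional.proper ℝ V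
  obtain ⟨δ, hδ, hmin⟩ : ∃ δ > 0, ∀ v ∈ Metric.sphere (0 : V) 1, δ ≤ h z₀ v v := by
    rcases (Metric.sphere (0 : V) 1).eq_empty_or_nonempty with hemp | hne
    · exact ⟨1, one_pos, by simp [hemp]⟩
    · obtain ⟨v, hv, hvmin⟩ := (isCompact_sphere (0 : V) 1).exists_isMinOn hne
        (f := fun v => h z₀ v v) (by fun_prop)
      exact ⟨h z₀ v v, hpos v (by rintro rfl; simp at hv), fun w hw => hvmin hw⟩
  refine ⟨δ / 2, half_pos hδ, ?_⟩
  filter_upwards [hcont.eventually (Metric.ball_mem_nhds (h z₀) (half_pos hδ))] with z hz v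
  have hz : ‖h z - h z₀‖ < δ / 2 := by rwa [← dist_eq_norm]
  have h1 : δ * ‖v‖ ^ 2 ≤ h z₀ v v := by
    rcases eq_or_ne v 0 with rfl | hv
    · simp
    · have hv' : ‖v‖ ≠ 0 := norm_ne_zero_iff.2 hv
      have h2 := hmin (‖v‖⁻¹ • v) (by simp [norm_smul, hv'])
      simp only [map_smul, _root_.smul_apply, smul_eq_mul] at h2
      have h3 : h z₀ v v = ‖v‖ ^ 2 * (‖v‖⁻¹ * (‖v‖⁻¹ * h z₀ v v)) := by field_simp
      rw [h3, mul_comm δ]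
      gcongr
  have h4 : |(h z - h z₀) v v| ≤ δ / 2 * ‖v‖ ^ 2 := by
    refine ((h z - h z₀).le_opNorm₂ v v).trans ?_
    rw [mul_assoc, ← sq]
    gcongr
  have h5 : (h z - h z₀) v v = h z v v - h z₀ v v := rfl
  rw [h5] at h4
  linarith [(abs_le.1 h4).1]

section ProductCurves

variable {n : ℕ} {M : Type*} [TopologicalSpace M] [ChartedSpace (EuclideanSpace ℝ (Fin n)) M]
  {c : ℝ → M × ℝ} {s : ℝ}

lemma hasDerivAt_snd_of_contMDiffAt (hc : ContMDiffAt 𝓘(ℝ, ℝ) ((𝓡 n).prod 𝓘(ℝ, ℝ)) 1 c s) :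
    HasDerivAt (fun r => (c r).2) (curveVelocity ((𝓡 n).prod 𝓘(ℝ, ℝ)) c s).2 s := by
  have h1 := (hc.mdifferentiableAt (by norm_num)).hasMFDerivAt
  have h2 := HasMFDerivAt.comp s (hasMFDerivAt_snd (I := 𝓡 n) (I' := 𝓘(ℝ, ℝ)) (c s)) h1
  have h3 : HasFDerivAt (fun r => (c r).2) ((ContinuousLinearMap.snd ℝ
      (EuclideanSpace ℝ (Fin n)) ℝ).comp
      (mfderiv 𝓘(ℝ, ℝ) ((𝓡 n).prod 𝓘(ℝ, ℝ)) c s : ℝ →L[ℝ] EuclideanSpace ℝ (Fin n) × ℝ)) s :=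
    h2.hasFDerivAt
  exact h3.hasDerivAt

lemma curveVelocity_fst (hc : ContMDiffAt 𝓘(ℝ, ℝ) ((𝓡 n).prod 𝓘(ℝ, ℝ)) 1 c s) :
    curveVelocity (𝓡 n) (fun r => (c r).1) s = (curveVelocity ((𝓡 n).prod 𝓘(ℝ, ℝ)) c s).1 := by
  have h1 := (hc.mdifferentiableAt (by norm_num)).hasMFDerivAt
  have h2 := HasMFDerivAt.comp s (hasMFDerivAt_fst (I := 𝓡 n) (I' := 𝓘(ℝ, ℝ)) (c s)) h1
  have h3 : HasMFDerivAt 𝓘(ℝ, ℝ) (𝓡 n) (fun r => (c r).1) s _ := h2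
  rw [curveVelocity, h3.mfderiv]
  rfl

end ProductCurves

section RiemannianDistance

variable {n : ℕ} {M : Type*} [TopologicalSpace M] [ChartedSpace (EuclideanSpace ℝ (Fin n)) M]
  [IsManifold (𝓡 n) ∞ M]

lemma riemannianDist_comm (γ : SmoothRiemannianMetric n M) (x y : M) :
    riemannianDist γ x y = riemannianDist γ y x := by
  let : Bundle.RiemannianBundle (fun x : M => TangentSpace (𝓡 n) x) := ⟨γ.toRiemannianMetric⟩
  exact Manifold.riemannianEDist_comm

/-- The distance between two points of a curve is at most its maximal speed times the elapsed
parameter. -/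
lemma riemannianDist_le_of_speed_le {γ : SmoothRiemannianMetric n M} {x : ℝ → M} {a b L : ℝ}
    (hab : a ≤ b) (hL : 0 ≤ L) (hx : ∀ r ∈ Icc a b, ContMDiffAt 𝓘(ℝ, ℝ) (𝓡 n) 1 x r)
    (hv : ∀ r ∈ Icc a b, metricAt (I := 𝓡 n) γ.inner (x r) (curveVelocity (𝓡 n) x r)
      (curveVelocity (𝓡 n) x r) ≤ L ^ 2) :
    riemannianDist γ (x a) (x b) ≤ ENNReal.ofReal (L * (b - a)) := by
  let : Bundle.RiemannianBundle (fun x : M => TangentSpace (𝓡 n) x) := ⟨γ.toRiemannianMetric⟩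
  have h1 : ∀ r ∈ Icc a b, ‖mfderiv 𝓘(ℝ, ℝ) (𝓡 n) x r 1‖ₑ ≤ ENNReal.ofReal L := by
    intro r hr
    rw [← ofReal_norm]
    refine ENNReal.ofReal_le_ofReal ?_
    rw [norm_eq_sqrt_real_inner]
    exact (Real.sqrt_le_sqrt (hv r hr)).trans (Real.sqrt_sq hL).le
  refine (Manifold.riemannianEDist_le_pathELength
    (fun r hr => (hx r hr).contMDiffWithinAt) rfl rfl hab).trans ?_
  rw [Manifold.pathELength_eq_lintegral_mfderiv_Icc]
  refine (setLIntegral_mono' measurableSet_Icc h1).trans ?_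
  rw [setLIntegral_const, Real.volume_Icc, ENNReal.ofReal_mul hL]

/-- In a complete manifold, a curve of bounded speed defined on `[a, b)` converges along any
monotone sequence of parameters tending to `b`. -/
lemma IsCompleteMetric.exists_tendsto {γ : SmoothRiemannianMetric n M} (hγ : IsCompleteMetric γ)
    {x : ℝ → M} {a b L : ℝ} (hL : 0 ≤ L) (hx : ∀ r ∈ Ico a b, ContMDiffAt 𝓘(ℝ, ℝ) (𝓡 n) 1 x r)
    (hv : ∀ r ∈ Ico a b, metricAt (I := 𝓡 n) γ.inner (x r) (curveVelocity (𝓡 n) x r)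
      (curveVelocity (𝓡 n) x r) ≤ L ^ 2)
    {u : ℕ → ℝ} (hmono : Monotone u) (hu : ∀ k, u k ∈ Ioo a b) (hub : Tendsto u atTop (𝓝 b)) :
    ∃ x₀, Tendsto (fun k => x (u k)) atTop (𝓝 x₀) := by
  refine hγ _ fun ε hε => ?_
  have hlim : Tendsto (fun k => ENNReal.ofReal (L * (b - u k))) atTop (𝓝 0) := by
    have h1 : Tendsto (fun k => L * (b - u k)) atTop (𝓝 (L * (b - b))) :=
      (hub.const_sub b).const_mul L
    simpa using ENNReal.tendsto_ofReal h1
  obtain ⟨k, hk⟩ := (hlim.eventually (gt_mem_nhds hε)).exists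
  have hle : ∀ i ≥ k, ∀ j ≥ i, riemannianDist γ (x (u i)) (x (u j)) < ε := fun i hi j hj => by
    have hsub : ∀ r ∈ Icc (u i) (u j), r ∈ Ico a b := fun r hr =>
      ⟨(hu i).1.le.trans hr.1, hr.2.trans_lt (hu j).2⟩
    refine (riemannianDist_le_of_speed_le (hmono hj) hL (fun r hr => hx r (hsub r hr))
      (fun r hr => hv r (hsub r hr))).trans_lt (lt_of_le_of_lt ?_ hk)
    exact ENNReal.ofReal_le_ofReal (mul_le_mul_of_nonneg_left
      (sub_le_sub (hu j).2.le (hmono hi)) hL)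
  refine ⟨k, fun i hi j hj => ?_⟩
  rcases le_total i j with hij | hij
  · exact hle i hi j hij
  · rw [riemannianDist_comm]
    exact hle j hj i hij

end RiemannianDistance

namespace SplitSpacetime

variable {n : ℕ} {M : Type*} [TopologicalSpace M] [ChartedSpace (EuclideanSpace ℝ (Fin n)) M]
  [IsManifold (𝓡 n) ∞ M] {S : SplitSpacetime n M} {c : ℝ → M × ℝ} {s a b : ℝ}

variable (S) in
/-- At the parameter `s`, the curve `c` is a future-directed causal geodesic of the spacetime. -/
def IsCausalGeodesicAt (c : ℝ → M × ℝ) (s : ℝ) : Prop :=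
  (IsGeodesicAt ((𝓡 n).prod 𝓘(ℝ, ℝ)) S.spacetimeMetric c s ∧ c s ∈ S.region) ∧
    0 < (curveVelocity ((𝓡 n).prod 𝓘(ℝ, ℝ)) c s).2 ∧
    metricAt S.spacetimeMetric (c s) (curveVelocity ((𝓡 n).prod 𝓘(ℝ, ℝ)) c s)
      (curveVelocity ((𝓡 n).prod 𝓘(ℝ, ℝ)) c s) ≤ 0

lemma IsCausalGeodesicAt.contMDiffAt (h : S.IsCausalGeodesicAt c s) :
    ContMDiffAt 𝓘(ℝ, ℝ) ((𝓡 n).prod 𝓘(ℝ, ℝ)) 1 c s :=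
  h.1.1.1.of_le (by norm_num)

/-- The energy of a causal geodesic stays bounded up to the end of a bounded parameter interval,
whether or not the time coordinate does. -/
lemma exists_energy_le (hlapse : S.BoundedLapse) (hexp : S.Expanding)
    (hgrad : S.IntegrablyBounded S.normGradLapse) (hP : S.IntegrablyBounded S.normTracelessPart)
    (hc : ∀ r ∈ Ioo a b, S.IsCausalGeodesicAt c r) (hs : s ∈ Ioo a b) :
    ∃ C, 0 < C ∧ ∀ r ∈ Ico s b, S.energy c r ≤ C := by
  obtain ⟨Nm, NM, hNm, hN⟩ := hlapse
  obtain ⟨f₁, hf₁, hf₁'⟩ := hgrad (c s).2 (hc s hs).1.2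
  obtain ⟨f₂, hf₂, hf₂'⟩ := hP (c s).2 (hc s hs).1.2
  have hsub : ∀ r ∈ Ico s b, r ∈ Ioo a b := fun r hr => ⟨hs.1.trans_le hr.1, hr.2⟩
  have ht : ∀ r ∈ Ico s b, HasDerivAt (fun r => (c r).2)
      (curveVelocity ((𝓡 n).prod 𝓘(ℝ, ℝ)) c r).2 r :=
    fun r hr => hasDerivAt_snd_of_contMDiffAt (hc r (hsub r hr)).contMDiffAt
  have hmono : MonotoneOn (fun r => (c r).2) (Ico s b) :=
    monotoneOn_of_deriv_nonneg (convex_Ico s b)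
      (fun r hr => (ht r hr).continuousAt.continuousWithinAt)
      (fun r hr => (ht r (interior_subset hr)).differentiableAt.differentiableWithinAt)
      (fun r hr => by
        rw [(ht r (interior_subset hr)).deriv]
        exact (hc r (hsub r (interior_subset hr))).2.1.le)
  refine exists_bound_of_deriv_le (t := fun r => (c r).2)
    (t' := fun r => (curveVelocity ((𝓡 n).prod 𝓘(ℝ, ℝ)) c r).2)
    (φ := fun r => f₁ r + NM * |f₂ r|) hs.2
    (fun r hr => hasDerivAt_energy (hc r (hsub r hr)).1.1 ?_ (hc r (hsub r hr)).1.2)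
    (fun r hr => mul_pos (S.lapse_pos _ (hc r (hsub r hr)).1.2) (hc r (hsub r hr)).2.1) ht
    (fun r hr => (hc r (hsub r hr)).2.1) (hf₁.add (hf₂.abs.const_mul NM)) (fun r hr => ?_)
  · filter_upwards [isOpen_Ioo.mem_nhds (hsub r hr)] with q hq
    exact (hc q hq).contMDiffAt
  · obtain ⟨hr1, hr2, hr3⟩ := hc r (hsub r hr)
    refine (energy_deriv_le hr1.2 (hexp _ hr1.2) hr2 hr3).trans ?_
    have h1 : (c s).2 ≤ (c r).2 := hmono ⟨le_rfl, hs.2⟩ hr hr.1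
    have hb1 : S.normGradLapse (c r) ≤ f₁ (c r).2 := hf₁' (c r).1 (c r).2 h1
    have hb2 : S.normTracelessPart (c r) ≤ |f₂ (c r).2| :=
      (hf₂' (c r).1 (c r).2 h1).trans (le_abs_self _)
    have hE : 0 ≤ S.energy c r := (mul_pos (S.lapse_pos _ hr1.2) hr2).le
    have hNr := hN _ hr1.2
    have hNP : S.lapse (c r) * S.normTracelessPart (c r) ≤ NM * |f₂ (c r).2| :=
      mul_le_mul hNr.2 hb2 (Real.sqrt_nonneg _) ((hNm.le.trans hNr.1).trans hNr.2)
    exact mul_le_mul_of_nonneg_left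
      (mul_le_mul_of_nonneg_left (add_le_add hb1 hNP) hr2.le) hE

/-- Along a causal curve, the spatial velocity is controlled by the energy. -/
lemma IsCausalGeodesicAt.sliceAt_spatialVelocity_le (h : S.IsCausalGeodesicAt c s) :
    S.sliceAt (c s) (S.spatialVelocity c s) (S.spatialVelocity c s) ≤ S.energy c s ^ 2 := by
  have h1 := h.2.2
  rw [metricAt_spacetimeMetric] at h1
  rw [energy, mul_pow, sq (curveVelocity ((𝓡 n).prod 𝓘(ℝ, ℝ)) c s).2]
  exact sub_nonpos.1 h1

lemma sliceAt_sub_smul_le (p : M × ℝ) (w β : EuclideanSpace ℝ (Fin n)) (r : ℝ) :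
    S.sliceAt p (w - r • β) (w - r • β)
      ≤ 2 * S.sliceAt p w w + 2 * (r ^ 2 * S.sliceAt p β β) := by
  have h := sliceAt_nonneg (S := S) p (w + r • β)
  simp only [map_add, map_sub, map_smul, _root_.add_apply, _root_.sub_apply,
    _root_.smul_apply, smul_eq_mul] at h ⊢
  linarith

/-- Near a point of the spacetime, the coordinate velocity of a causal curve is controlled by its
energy. -/
lemma exists_eventually_norm_deriv_le {f : OpenPartialHomeomorph M (EuclideanSpace ℝ (Fin n))}
    (hf : f ∈ atlas (EuclideanSpace ℝ (Fin n)) M) {p₀ : M × ℝ} (hp₀ : p₀ ∈ S.region)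
    (hpf : p₀.1 ∈ f.source) (C D : ℝ) :
    ∃ K, ∀ᶠ p in 𝓝 p₀, ∀ s, c s = p → S.IsCausalGeodesicAt c s → S.energy c s ≤ C →
      (curveVelocity ((𝓡 n).prod 𝓘(ℝ, ℝ)) c s).2 ≤ D →
      ‖deriv ((spacetimeChart f).extend ((𝓡 n).prod 𝓘(ℝ, ℝ)) ∘ c) s‖ ≤ K := by
  have htgt : f.extend (𝓡 n) p₀.1 ∈ (f.extend (𝓡 n)).target := mem_extend_target hpf
  have he := spacetimeChart_mem_atlas hf
  set φ := (spacetimeChart f).extend ((𝓡 n).prod 𝓘(ℝ, ℝ)) with hφ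
  have hφc : ContinuousAt φ p₀ := (contMDiffAt_extend_of_mem_atlas (I := (𝓡 n).prod 𝓘(ℝ, ℝ)) he
    (mem_spacetimeChart_source.2 hpf)).continuousAt
  have hpos : ∀ v, v ≠ 0 → 0 < S.coordSlice f (φ p₀) v v := by
    intro v hv
    refine (S.slice p₀.2).pos _ _ fun h => hv ?_
    rw [← chartCoframe_chartFrame (I := 𝓡 n) hf htgt v]
    exact (congrArg (chartCoframe (𝓡 n) f ((f.extend (𝓡 n)).symm (f.extend (𝓡 n) p₀.1))) h).trans
      (map_zero _)
  obtain ⟨δ, hδ, hev⟩ := exists_eventually_mul_sq_le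
    (contDiffAt_coordSlice (S := S) (z := φ p₀) hf htgt hp₀).continuousAt hpos
  have hβ : ∀ᶠ z in 𝓝 (φ p₀), ‖S.coordShift f z‖ ≤ ‖S.coordShift f (φ p₀)‖ + 1 :=
    (((contDiffAt_coordShift (S := S) (z := φ p₀) hf htgt hp₀).continuousAt.norm.eventually
      (gt_mem_nhds (lt_add_one _)))).mono fun z hz => hz.le
  set B := ‖S.coordShift f (φ p₀)‖ + 1 with hB
  refine ⟨max (Real.sqrt (C ^ 2 / δ) + D * B) D, ?_⟩
  filter_upwards [hφc.eventually hev, hφc.eventually hβ, ((spacetimeChart f).open_source.mem_nhds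
    (mem_spacetimeChart_source.2 hpf))] with p h1 h2 hpsrc s hs hc hC hD
  subst hs
  have hcs : (c s).1 ∈ f.source := mem_spacetimeChart_source.1 hpsrc
  have hvel := mfderiv_eq_chartFrame he hpsrc hc.contMDiffAt
  have hctgt : (φ (c s)).1 ∈ (f.extend (𝓡 n)).target := mem_extend_target hcs
  set x' := deriv (φ ∘ c) s with hx'
  have hvel2 : (curveVelocity ((𝓡 n).prod 𝓘(ℝ, ℝ)) c s).2 = x'.2 := by
    rw [hvel, ← hφ, chartFrame_spacetimeChart hf hctgt]
  have hcausal := hc.2.2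
  rw [← coordMetric_deriv_deriv he hpsrc hc.contMDiffAt, ← hφ,
    coordMetric_spacetimeMetric hf hctgt, ← hx'] at hcausal
  have hlap : S.coordLapse f (φ (c s)) = S.lapse (c s) :=
    congrArg S.lapse (Prod.ext (extend_left_inv' (I := 𝓡 n) hcs) rfl)
  have hpos2 : 0 < x'.2 := hvel2 ▸ hc.2.1
  have hE : 0 < S.lapse (c s) * x'.2 := mul_pos (S.lapse_pos _ hc.1.2) hpos2
  have hE2 : S.lapse (c s) * x'.2 ≤ C := by rw [← hvel2]; exact hC
  set w := x'.1 + x'.2 • S.coordShift f (φ (c s)) with hw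
  have hw2 : ‖w‖ ≤ Real.sqrt (C ^ 2 / δ) := by
    refine Real.le_sqrt_of_sq_le ((le_div_iff₀ hδ).2 ?_)
    have h3 := h1 w
    have h4 : S.lapse (c s) ^ 2 * (x'.2 * x'.2) ≤ C ^ 2 := by
      rw [← sq, ← mul_pow]
      exact pow_le_pow_left₀ hE.le hE2 2
    rw [hlap] at hcausal
    linarith
  have hx1 : x'.1 = w - x'.2 • S.coordShift f (φ (c s)) := by rw [hw]; abel
  rw [hvel2] at hD
  refine max_le ?_ ?_
  · refine le_max_of_le_left ?_
    rw [hx1]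
    refine (norm_sub_le _ _).trans (add_le_add hw2 ?_)
    rw [norm_smul, Real.norm_of_nonneg hpos2.le]
    exact mul_le_mul hD h2 (norm_nonneg _) (hpos2.le.trans hD)
  · refine le_max_of_le_right ?_
    rwa [Real.norm_of_nonneg hpos2.le]

/-- Under the hypotheses on the spacetime, a causal geodesic defined up to a finite parameter `b`
extends, as a geodesic, beyond `b`. -/
lemma exists_extension [T2Space M] (hlapse : S.BoundedLapse) (hslice : S.SliceComplete)
    (hshift : S.BoundedShift) (hexp : S.Expanding)
    (hgrad : S.IntegrablyBounded S.normGradLapse) (hP : S.IntegrablyBounded S.normTracelessPart)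
    (hab : a < b) (hc : ∀ r ∈ Ioo a b, S.IsCausalGeodesicAt c r) :
    ∃ b' > b, ∃ c' : ℝ → M × ℝ, EqOn c' c (Ioo a b) ∧ ∀ r ∈ Ioo a b',
      IsGeodesicAt ((𝓡 n).prod 𝓘(ℝ, ℝ)) S.spacetimeMetric c' r ∧ c' r ∈ S.region := by
  obtain ⟨s, hs⟩ := nonempty_Ioo.2 hab
  obtain ⟨C, hC, hEC⟩ := exists_energy_le hlapse hexp hgrad hP hc hs
  obtain ⟨Nm, NM, hNm, hN⟩ := hlapse
  obtain ⟨-, γ, hγ, A, hA, hAγ⟩ := hslice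
  obtain ⟨B, hB⟩ := hshift
  have hsub : ∀ r ∈ Ico s b, r ∈ Ioo a b := fun r hr => ⟨hs.1.trans_le hr.1, hr.2⟩
  have ht : ∀ r ∈ Ico s b, HasDerivAt (fun r => (c r).2)
      (curveVelocity ((𝓡 n).prod 𝓘(ℝ, ℝ)) c r).2 r :=
    fun r hr => hasDerivAt_snd_of_contMDiffAt (hc r (hsub r hr)).contMDiffAt
  have hD : ∀ r ∈ Ico s b, (curveVelocity ((𝓡 n).prod 𝓘(ℝ, ℝ)) c r).2 ≤ C / Nm := fun r hr => by
    rw [le_div_iff₀ hNm, mul_comm]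
    have h1 := hc r (hsub r hr)
    exact (mul_le_mul_of_nonneg_right (hN _ h1.1.2).1 h1.2.1.le).trans (hEC r hr)
  obtain ⟨u, hu, hus, hub⟩ := exists_seq_strictMono_tendsto' hs.2
  have huI : ∀ k, u k ∈ Ico s b := fun k => ⟨(hus k).1.le, (hus k).2⟩
  -- the time coordinate increases to a finite limit
  have htdiff : DifferentiableOn ℝ (fun r => (c r).2) (Ico s b) :=
    fun r hr => (ht r hr).differentiableAt.differentiableWithinAt
  have htmono : MonotoneOn (fun r => (c r).2) (Ico s b) :=
    monotoneOn_of_deriv_nonneg (convex_Ico s b) htdiff.continuousOn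
      (htdiff.mono interior_subset)
      (fun r hr => by
        rw [(ht r (interior_subset hr)).deriv]
        exact (hc r (hsub r (interior_subset hr))).2.1.le)
  have htbdd : BddAbove (range fun k => (c (u k)).2) := by
    refine ⟨(c s).2 + C / Nm * (b - s), ?_⟩
    rintro _ ⟨k, rfl⟩
    have h1 := (convex_Ico s b).image_sub_le_mul_sub_of_deriv_le htdiff.continuousOn
      (htdiff.mono interior_subset) (C := C / Nm) (fun r hr => by
        rw [(ht r (interior_subset hr)).deriv]
        exact hD r (interior_subset hr)) s ⟨le_rfl, hs.2⟩ (u k) (huI k) (huI k).1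
    have h2 : C / Nm * (u k - s) ≤ C / Nm * (b - s) :=
      mul_le_mul_of_nonneg_left (by linarith [(huI k).2]) (div_pos hC hNm).le
    simp only at h1 ⊢
    linarith
  have hT := tendsto_atTop_ciSup
    (fun i j hij => htmono (huI i) (huI j) (hu.monotone hij)) htbdd
  set T := ⨆ k, (c (u k)).2 with hTdef
  have hTt : S.t₀ < T := lt_of_lt_of_le (hc _ (hsub _ (huI 0))).1.2 (le_ciSup htbdd 0)
  -- the projection to the slice has bounded speed, hence converges
  set L := Real.sqrt ((2 * C ^ 2 + 2 * ((C / Nm) ^ 2 * B ^ 2)) / A) with hL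
  have hx : ∀ r ∈ Ico s b, ContMDiffAt 𝓘(ℝ, ℝ) (𝓡 n) 1 (fun r => (c r).1) r :=
    fun r hr => contMDiffAt_fst.comp r (hc r (hsub r hr)).contMDiffAt
  have hspeed : ∀ r ∈ Ico s b, metricAt (I := 𝓡 n) γ.inner (c r).1
      (curveVelocity (𝓡 n) (fun r => (c r).1) r)
      (curveVelocity (𝓡 n) (fun r => (c r).1) r) ≤ L ^ 2 := by
    intro r hr
    have hcr := hc r (hsub r hr)
    rw [curveVelocity_fst hcr.contMDiffAt, hL, Real.sq_sqrt (by positivity), le_div_iff₀ hA,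
      mul_comm]
    refine (hAγ (c r) hcr.1.2 _).trans ?_
    have hβ : S.sliceAt (c r) (S.shiftAt (c r)) (S.shiftAt (c r)) ≤ B ^ 2 := by
      have h1 := hB (c r) hcr.1.2
      exact (Real.sqrt_le_left ((Real.sqrt_nonneg _).trans h1)).1 h1
    have hE : S.energy c r ^ 2 ≤ C ^ 2 := pow_le_pow_left₀
      (mul_pos (S.lapse_pos _ hcr.1.2) hcr.2.1).le (hEC r hr) 2
    have hu0 : (curveVelocity ((𝓡 n).prod 𝓘(ℝ, ℝ)) c r).2 ^ 2 ≤ (C / Nm) ^ 2 :=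
      pow_le_pow_left₀ hcr.2.1.le (hD r hr) 2
    have hv : (curveVelocity ((𝓡 n).prod 𝓘(ℝ, ℝ)) c r).1 = S.spatialVelocity c r
        - (curveVelocity ((𝓡 n).prod 𝓘(ℝ, ℝ)) c r).2 • S.shiftAt (c r) := by
      rw [spatialVelocity, add_sub_cancel_right]
    change S.sliceAt (c r) (curveVelocity ((𝓡 n).prod 𝓘(ℝ, ℝ)) c r).1
      (curveVelocity ((𝓡 n).prod 𝓘(ℝ, ℝ)) c r).1 ≤ _
    rw [hv]
    refine (sliceAt_sub_smul_le _ _ _ _).trans ?_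
    have h5 := mul_le_mul hu0 hβ (sliceAt_nonneg _ _) (sq_nonneg _)
    linarith [hcr.sliceAt_spatialVelocity_le]
  obtain ⟨x₀, hx₀⟩ := hγ.exists_tendsto (Real.sqrt_nonneg _) hx hspeed hu.monotone hus hub
  have hcu : Tendsto (fun k => c (u k)) atTop (𝓝 (x₀, T)) := hx₀.prodMk_nhds hT
  have hfa : chartAt (EuclideanSpace ℝ (Fin n)) x₀ ∈ atlas (EuclideanSpace ℝ (Fin n)) M :=
    chart_mem_atlas _ _
  have hxf : x₀ ∈ (chartAt (EuclideanSpace ℝ (Fin n)) x₀).source := mem_chart_source _ _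
  obtain ⟨K, hK⟩ := exists_eventually_norm_deriv_le (S := S) (c := c) hfa (p₀ := (x₀, T)) hTt hxf
    C (C / Nm)
  refine isPseudoMetricOn_spacetimeMetric.exists_extension isOpen_region
    (fun r hr => (hc r hr).1) (p₀ := (x₀, T)) hTt (spacetimeChart_mem_atlas hfa)
    (mem_spacetimeChart_source.2 hxf) (fun k => hsub _ (huI k)) hub hcu (C := K) ?_
  filter_upwards [hcu.eventually hK] with k hk
  exact hk (u k) rfl (hc _ (hsub _ (huI k))) (hEC _ (huI k)) (hD _ (huI k))

end SplitSpacetime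

/-! ### Continuation to all affine parameters -/

/-- Continuation of solutions of a local problem: if every curve on a bounded interval `(a, d)`
with the local property `P` extends beyond `d`, then it extends to `(a, ∞)`. No uniqueness is
needed: a maximal continuation exists by Zorn's lemma. -/
lemma exists_extension_Ioi {X : Type*} {P : (ℝ → X) → ℝ → Prop}
    (hcongr : ∀ c c' s, P c s → c =ᶠ[𝓝 s] c' → P c' s) {a b : ℝ} (hab : a < b)
    (hext : ∀ d c, a < d → (∀ r ∈ Ioo a d, P c r) →
      ∃ d' > d, ∃ c', EqOn c' c (Ioo a d) ∧ ∀ r ∈ Ioo a d', P c' r)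
    {c : ℝ → X} (hc : ∀ r ∈ Ioo a b, P c r) :
    ∃ c', EqOn c' c (Ioo a b) ∧ ∀ r ∈ Ioi a, P c' r := by
  -- the continuations of `c`, with endpoints in `[b, ∞]`
  let α := {x : EReal × (ℝ → X) // (b : EReal) ≤ x.1 ∧ EqOn x.2 c (Ioo a b) ∧
    ∀ r : ℝ, a < r → (r : EReal) < x.1 → P x.2 r}
  let R : α → α → Prop := fun x y => x.1.1 ≤ y.1.1 ∧
    ∀ r : ℝ, a < r → (r : EReal) < x.1.1 → y.1.2 r = x.1.2 r
  have : Nonempty α := ⟨⟨(b, c), le_rfl, fun _ _ => rfl, fun r h1 h2 =>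
    hc r ⟨h1, EReal.coe_lt_coe_iff.1 h2⟩⟩⟩
  obtain ⟨⟨⟨d, f⟩, hbd, hfc, hf⟩, hmax⟩ : ∃ m : α, ∀ x, R m x → R x m := by
    refine exists_maximal_of_nonempty_chains_bounded (fun C hC hne => ?_)
      (fun {x y z} hxy hyz => ⟨hxy.1.trans hyz.1, fun r h1 h2 =>
        (hyz.2 r h1 (h2.trans_le hxy.1)).trans (hxy.2 r h1 h2)⟩)
    classical
    let F : ℝ → X := fun r =>
      if h : ∃ y ∈ C, (r : EReal) < y.1.1 then h.choose.1.2 r else c r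
    have hF : ∀ y ∈ C, ∀ r : ℝ, a < r → (r : EReal) < y.1.1 → F r = y.1.2 r := by
      intro y hy r har hr
      have h : ∃ y ∈ C, (r : EReal) < y.1.1 := ⟨y, hy, hr⟩
      have hFr : F r = h.choose.1.2 r := dif_pos h
      rw [hFr]
      rcases eq_or_ne h.choose y with heq | hne
      · rw [heq]
      · rcases hC h.choose_spec.1 hy hne with hR | hR
        · exact (hR.2 r har h.choose_spec.2).symm
        · exact hR.2 r har hr
    obtain ⟨y₀, hy₀⟩ := hne
    have hle : ∀ y ∈ C, y.1.1 ≤ sSup ((fun y : α => y.1.1) '' C) :=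
      fun y hy => le_sSup ⟨y, hy, rfl⟩
    refine ⟨⟨(sSup ((fun y : α => y.1.1) '' C), F), y₀.2.1.trans (hle y₀ hy₀), fun r hr => ?_,
      fun r har hr => ?_⟩, fun y hy => ⟨hle y hy, hF y hy⟩⟩
    · exact (hF y₀ hy₀ r hr.1 ((EReal.coe_lt_coe_iff.2 hr.2).trans_le y₀.2.1)).trans (y₀.2.2.1 hr)
    · obtain ⟨_, ⟨y, hy, rfl⟩, hry⟩ := lt_sSup_iff.1 hr
      refine hcongr _ _ r (y.2.2.2 r har hry) ?_
      filter_upwards [Ioi_mem_nhds har,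
        (continuous_coe_real_ereal.tendsto r).eventually (gt_mem_nhds hry)] with q h1 h2
      exact (hF y hy q h1 h2).symm
  induction d with
  | bot => exact absurd hbd (by simp)
  | top => exact ⟨f, hfc, fun r hr => hf r hr (EReal.coe_lt_top r)⟩
  | coe d =>
    have hbd' : b ≤ d := EReal.coe_le_coe_iff.1 hbd
    obtain ⟨d', hd', f', hf', hP⟩ := hext d f (hab.trans_le hbd') fun r hr =>
      hf r hr.1 (EReal.coe_lt_coe_iff.2 hr.2)
    have h := hmax ⟨(d', f'), hbd.trans (EReal.coe_le_coe_iff.2 hd'.le),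
      fun r hr => (hf' ⟨hr.1, hr.2.trans_le hbd'⟩).trans (hfc hr),
      fun r h1 h2 => hP r ⟨h1, EReal.coe_lt_coe_iff.1 h2⟩⟩
      ⟨EReal.coe_le_coe_iff.2 hd'.le, fun r h1 h2 => hf' ⟨h1, EReal.coe_lt_coe_iff.1 h2⟩⟩
    exact absurd (EReal.coe_le_coe_iff.1 h.1) (not_le.2 hd')

namespace SplitSpacetime

variable {n : ℕ} {M : Type*} [TopologicalSpace M] [ChartedSpace (EuclideanSpace ℝ (Fin n)) M]
  [IsManifold (𝓡 n) ∞ M] {S : SplitSpacetime n M} {c : ℝ → M × ℝ} {s a b : ℝ}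

lemma IsCausalGeodesicAt.congr {c' : ℝ → M × ℝ} (h : S.IsCausalGeodesicAt c s)
    (hc : c =ᶠ[𝓝 s] c') : S.IsCausalGeodesicAt c' s := by
  obtain ⟨⟨h1, h2⟩, h3⟩ := h
  rw [curveVelocity_congr hc, hc.self_of_nhds] at h3
  exact ⟨⟨h1.congr hc, hc.self_of_nhds ▸ h2⟩, h3⟩

/-- The time component of the velocity of a geodesic is continuous. -/
lemma continuousOn_curveVelocity_snd
    (hgeo : ∀ r ∈ Ioo a b, IsGeodesicAt ((𝓡 n).prod 𝓘(ℝ, ℝ)) S.spacetimeMetric c r) :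
    ContinuousOn (fun r => (curveVelocity ((𝓡 n).prod 𝓘(ℝ, ℝ)) c r).2) (Ioo a b) := by
  have ht : ContDiffOn ℝ 2 (fun r => (c r).2) (Ioo a b) := fun r hr =>
    (ContMDiffAt.contDiffAt
      (contMDiffAt_snd.comp r (hgeo r hr).1)).contDiffWithinAt
  refine (ht.continuousOn_deriv_of_isOpen isOpen_Ioo (by norm_num)).congr fun r hr => ?_
  exact (hasDerivAt_snd_of_contMDiffAt ((hgeo r hr).1.of_le (by norm_num))).deriv.symm

/-- A geodesic which is future-directed and causal at one parameter is so at every parameter, and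
the square of its velocity is constant. -/
lemma isCausalGeodesicAt_of_mem [T2Space M] (hgeo : ∀ r ∈ Ioo a b,
      IsGeodesicAt ((𝓡 n).prod 𝓘(ℝ, ℝ)) S.spacetimeMetric c r ∧ c r ∈ S.region)
    (hs : s ∈ Ioo a b) (h : S.IsCausalGeodesicAt c s) :
    ∀ r ∈ Ioo a b, S.IsCausalGeodesicAt c r := by
  have hsq := fun r (hr : r ∈ Ioo a b) =>
    isPseudoMetricOn_spacetimeMetric.metricAt_curveVelocity_eq hgeo hr hs
  -- a causal vector without time component vanishes
  have hne : ∀ r ∈ Ioo a b, (curveVelocity ((𝓡 n).prod 𝓘(ℝ, ℝ)) c r).2 ≠ 0 := by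
    intro r hr h0
    have h1 := (hsq r hr).trans_le h.2.2
    rw [metricAt_spacetimeMetric, h0] at h1
    simp only [zero_smul, add_zero, mul_zero, sub_zero] at h1
    have h2 : (curveVelocity ((𝓡 n).prod 𝓘(ℝ, ℝ)) c r).1 = 0 := by
      by_contra hv
      exact (sliceAt_pos _ _ hv).not_ge h1
    have h3 := isPseudoMetricOn_spacetimeMetric.curveVelocity_eq_zero hgeo hr (Prod.ext h2 h0) s hs
    exact h.2.1.ne' (by rw [h3]; rfl)
  intro r hr
  refine ⟨hgeo r hr, ?_, (hsq r hr).trans_le h.2.2⟩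
  by_contra hneg
  obtain ⟨q, hq, hq0⟩ := isPreconnected_Ioo.intermediate_value hr hs
    (continuousOn_curveVelocity_snd fun r hr => (hgeo r hr).1)
    (show (0 : ℝ) ∈ Icc _ _ from ⟨not_lt.1 hneg, h.2.1.le⟩)
  exact hne q hq hq0

/-- Future causal geodesic completeness. The extension stays timelike (null) by conservation of the
square of the velocity. -/
lemma exists_causal_extension_Ioi [T2Space M] (hlapse : S.BoundedLapse) (hslice : S.SliceComplete)
    (hshift : S.BoundedShift) (hexp : S.Expanding)
    (hgrad : S.IntegrablyBounded S.normGradLapse) (hP : S.IntegrablyBounded S.normTracelessPart)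
    (hab : a < b) (hc : ∀ r ∈ Ioo a b, S.IsCausalGeodesicAt c r) :
    ∃ c' : ℝ → M × ℝ, EqOn c' c (Ioo a b) ∧ ∀ r ∈ Ioi a, S.IsCausalGeodesicAt c' r := by
  refine exists_extension_Ioi (fun _ _ _ => IsCausalGeodesicAt.congr) hab
    (fun d c had hc => ?_) hc
  obtain ⟨d', hd', c', hc'c, hc'⟩ := exists_extension hlapse hslice hshift hexp hgrad hP had hc
  obtain ⟨s, hs⟩ := nonempty_Ioo.2 had
  refine ⟨d', hd', c', hc'c, isCausalGeodesicAt_of_mem hc' ⟨hs.1, hs.2.trans hd'⟩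
      ((hc s hs).congr ?_)⟩
  filter_upwards [isOpen_Ioo.mem_nhds hs] with q hq
  exact (hc'c hq).symm

lemma isCausalGeodesicAt_of_isGeodesic {J : Set ℝ} (hJ : IsOpen J) (h : S.IsGeodesic c J)
    (hc : ∀ s ∈ J, 0 < S.dt (c s) (S.velocity c s) ∧
      S.spacetimeMetric (c s) (S.velocity c s) (S.velocity c s) ≤ 0) :
    ∀ s ∈ J, S.IsCausalGeodesicAt c s :=
  fun s hs => ⟨⟨(isGeodesicOn_iff hJ).1 h.2 s hs, h.1 hs⟩, hc s hs⟩

/-- The extension of a causal geodesic has the causal character of the geodesic. -/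
lemma isGeodesic_Ioi_of_eqOn [T2Space M] {c' : ℝ → M × ℝ} (hab : a < b)
    (hc' : ∀ r ∈ Ioi a, S.IsCausalGeodesicAt c' r) (heq : EqOn c' c (Ioo a b)) :
    S.IsGeodesic c' (Ioi a) ∧ ∃ s₀ ∈ Ioo a b, ∀ s ∈ Ioi a, 0 < S.dt (c' s) (S.velocity c' s) ∧
      S.spacetimeMetric (c' s) (S.velocity c' s) (S.velocity c' s)
        = S.spacetimeMetric (c s₀) (S.velocity c s₀) (S.velocity c s₀) := by
  obtain ⟨s₀, hs₀⟩ := nonempty_Ioo.2 hab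
  refine ⟨⟨fun r hr => (hc' r hr).1.2, (isGeodesicOn_iff isOpen_Ioi).2 fun r hr => (hc' r hr).1.1⟩,
    s₀, hs₀, fun s hs => ⟨(hc' s hs).2.1, ?_⟩⟩
  have h1 := isPseudoMetricOn_spacetimeMetric.metricAt_curveVelocity_eq (a := a)
    (b := max s s₀ + 1) (fun r hr => (hc' r hr.1).1) (s := s) (r := s₀)
    ⟨hs, (le_max_left _ _).trans_lt (lt_add_one _)⟩
    ⟨hs₀.1, (le_max_right _ _).trans_lt (lt_add_one _)⟩
  have h2 : c' =ᶠ[𝓝 s₀] c := heq.eventuallyEq_of_mem (isOpen_Ioo.mem_nhds hs₀)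
  rw [curveVelocity_congr h2, h2.self_of_nhds] at h1
  exact h1

end SplitSpacetime

end

theorem mainTheorem3 (n : ℕ) (M : Type*) [TopologicalSpace M] [T2Space M]
    [ChartedSpace (EuclideanSpace ℝ (Fin n)) M] [IsManifold (𝓡 n) ∞ M]
    (S : SplitSpacetime n M)
    (hlapse : S.BoundedLapse) (hslice : S.SliceComplete) (hshift : S.BoundedShift)
    (hexp : S.Expanding)
    (hgrad : S.IntegrablyBounded S.normGradLapse)
    (hP : S.IntegrablyBounded S.normTracelessPart) :
    S.FutureTimelikeGeodesicallyComplete ∧ S.FutureNullGeodesicallyComplete := by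
  constructor
  · intro a b c hab hc
    obtain ⟨c', heq, hc'⟩ := SplitSpacetime.exists_causal_extension_Ioi hlapse hslice hshift hexp
      hgrad hP hab (SplitSpacetime.isCausalGeodesicAt_of_isGeodesic isOpen_Ioo hc.1
        fun s hs => ⟨(hc.2 s hs).1, (hc.2 s hs).2.le⟩)
    obtain ⟨hgeo, s₀, hs₀, h⟩ := SplitSpacetime.isGeodesic_Ioi_of_eqOn hab hc' heq
    exact ⟨c', heq, hgeo, fun s hs => ⟨(h s hs).1, (h s hs).2.trans_lt (hc.2 s₀ hs₀).2⟩⟩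
  · intro a b c hab hc
    obtain ⟨c', heq, hc'⟩ := SplitSpacetime.exists_causal_extension_Ioi hlapse hslice hshift hexp
      hgrad hP hab (SplitSpacetime.isCausalGeodesicAt_of_isGeodesic isOpen_Ioo hc.1
        fun s hs => ⟨(hc.2 s hs).1, (hc.2 s hs).2.le⟩)
    obtain ⟨hgeo, s₀, hs₀, h⟩ := SplitSpacetime.isGeodesic_Ioi_of_eqOn hab hc' heq
    exact ⟨c', heq, hgeo, fun s hs => ⟨(h s hs).1, (h s hs).2.trans (hc.2 s₀ hs₀).2⟩⟩
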